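/- **Setting.** Let $M=(Q,\Sigma,\Gamma,\delta,q_0,B,F)$ be a deterministic Turing machine with finite $Q,\Gamma$, $\Sigma\subset\Gamma$, $B\in\Gamma\setminus\Sigma$, a partial next-move function $\delta:Q\times\Gamma\rightharpoonup Q\times\Gamma\times\{L,R\}$, and a tape with a leftmost cell that is infinite to the right. $M$ starts in state $q_0$ with its head on the leftmost cell and the input $w\in\Sigma^*$ written from the leftmost cell on, all other cells being blank. $M$ *halts* when no further move is possible. It is assumed that, on input $w$, $M$ never tries to move its head to the left of the leftmost cell. The *self-similar cellular automaton* $A_M$ has cells indexed by $k\in\mathbb Z$. Cell $k$ changes its state at the times $2^{-k},2\cdot2^{-k},3\cdot 2^{-k},\dots$ (time unit: the cycle of cell $0$). At time $j2^{-k}$, $j\ge1$, its new state is $f(x,y,z,c)$, where $x,y,z$ are the states of the cells $k-1,k,k+1$ immediately before that time if $j$ is even (then $c=1$, "coupled": cell $k-1$ changes its state at the same time); if $j$ is odd, then $c=0$, and $x$ is the state of cell $k-1$, which does not change its state at that time. The state set is $$Z=\Gamma\cup\{\overrightarrow a\}\cup\{\langle q,a\rangle\}\cup\{\overrightarrow{\langle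 q,a\rangle}\}\cup\{\Box,\blacktriangleleft,\lhd,\overrightarrow\lhd,\rhd,\rhd_B,\rhd_\blacktriangleleft\}\qquad(a\in\Gamma,\ q\in Q),$$ and $f$ is given by the following block transformations $z_1z_2\mapsto z_1'z_2'$, for $a,b\in\Gamma$, $q\in Q$: - $\overrightarrow\lhd\,\langle q,a\rangle\mapsto\lhd\,\overrightarrow{\langle q,a\rangle}$; $\ \overrightarrow a\,b\mapsto a\,\overrightarrow b$; $\ \overrightarrow\lhd\,a\mapsto\lhd\,\overrightarrow a$; - if $\delta(q,a)=(p,c,R)$: $\ \overrightarrow b\,\langle q,a\rangle\mapsto b\,\overrightarrow{\langle q,a\rangle}$; $\ \overrightarrow{\langle q,a\rangle}\,b\mapsto c\,\overrightarrow{\langle p,b\rangle}$; $\ \overrightarrow{\langle q,a\rangle}\,\rhd\mapsto\langle q,a\rangle\,\rhd_B$; - if $\delta(q,a)=(p,c,L)$: $\ \overrightarrow b\,\langle q,a\rangle\mapsto\langle p,b\rangle\,\overrightarrow c$; $\ \overrightarrow{\langle q,a\rangle}\,b\mapsto\langle q,a\rangle\,\overrightarrow b$; $\ \overrightarrow{\langle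 q,a\rangle}\,\rhd\mapsto\langle q,a\rangle\,\rhd_\blacktriangleleft$; - $\overrightarrow a\,\rhd\mapsto a\,\rhd_\blacktriangleleft$; $\ \rhd_B\,\Box\mapsto B\,\rhd_\blacktriangleleft$; $\ \rhd_\blacktriangleleft\,\Box\mapsto\blacktriangleleft\,\rhd$; - $a\,\blacktriangleleft\mapsto\blacktriangleleft\,a$; $\ \langle q,a\rangle\,\blacktriangleleft\mapsto\blacktriangleleft\,\langle q,a\rangle$; $\ \lhd\,\blacktriangleleft\mapsto\Box\,\overrightarrow\lhd$. Here $z_1z_2\mapsto z_1'z_2'$ means $f(x,z_1,z_2,0)=f(x,z_1,z_2,1)=z_1'$ and $f(z_1,z_2,y,1)=z_2'$ for all $x,y\in Z$. If no block transformation applies to $(x,y,z,c)$, then $f(x,y,z,c)=y$ (in particular $f(\Box,\Box,z,c)=\Box$); if two apply at once, then $f(x,y,z,c)$ may be chosen arbitrarily. The initial configuration $C_0(w)$ at time $0$ has, from cell $0$ on, the states $\overrightarrow\lhd\langle q_0,a_1\rangle a_2\dots a_n\rhd$ if $w=a_1\dots a_n$ with $n\ge2$, $\ \overrightarrow\lhd\langle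 q_0,a_1\rangle B\rhd$ if $w=a_1$, and $\overrightarrow\lhd\langle q_0,B\rangle B\rhd$ if $w$ is empty; all other cells are in state $\Box$. A configuration is *final* if it does not change anymore. **Theorem.** The evolution of $A_M$ from $C_0(w)$ exists and is unique, and: 1. If $M$ halts on $w$, then at some time less than $6$ (cycles of cell $0$) $A_M$ is in a final configuration, and this configuration holds the result between the delimiters: it is of the form $\cdots\Box\Box\lhd z_0\dots z_{n-1}\rhd\Box\Box\cdots$, where, up to arrows, $z_j$ is the symbol in the $j$-th tape cell of the halting configuration of $M$ (together with the state of $M$ if the head of $M$ is there), the head is among these $n$ cells, and all further tape cells of $M$ are blank. 2. If $M$ does not halt on $w$, then $A_M$ enters the final configuration $\Box^\infty$, in which all cells are quiescent, after exactly $6$ cycles of cell $0$: it is in this configuration at all times $t\ge6$ and at no time $0\le t<6$. -/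

import Mathlib

/-! ### Turing machines with a one-sided tape -/

/-- A deterministic Turing machine `(Q, Σ, Γ, δ, q₀, B, F)`; the next-move function may be undefined
(`none`) for some arguments. -/
structure TuringMachine (Q Γ : Type*) where
  inputSymbols : Set Γ
  delta : Q → Γ → Option (Q × Γ × Turing.Dir)
  startState : Q
  blank : Γ
  blank_notMem : blank ∉ inputSymbols
  finalStates : Set Q

/-- A configuration of a Turing machine: state, position of the head, tape content.
The tape cells are numbered `0, 1, 2, …` from the leftmost one. -/
structure TMConfig (Q Γ : Type*) where
  state : Q
  head : ℕ
  tape : ℕ → Γ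

namespace TuringMachine

variable {Q Γ : Type*} (M : TuringMachine Q Γ)

/-- The start configuration on the input word `w`. -/
def initConfig (w : List Γ) : TMConfig Q Γ where
  state := M.startState
  head := 0
  tape := fun j => w.getD j M.blank

/-- One move. There is no next configuration if `δ` is undefined, or if the head would have
to leave the tape at its left end. -/
def step (c : TMConfig Q Γ) : Option (TMConfig Q Γ) :=
  match M.delta c.state (c.tape c.head) with
  | none => none
  | some (p, b, .right) => some ⟨p, c.head + 1, Function.update c.tape c.head b⟩
  | some (p, b, .left) =>
      if c.head = 0 then none else some ⟨p, c.head - 1, Function.update c.tape c.head b⟩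

/-- `c` is reached in finitely many moves from the start configuration on `w`. -/
def Reaches (w : List Γ) (c : TMConfig Q Γ) : Prop :=
  Relation.ReflTransGen (fun c₁ c₂ => M.step c₁ = some c₂) (M.initConfig w) c

/-- On input `w` the machine halts in the configuration `c`: no further move is possible. -/
def HaltsIn (w : List Γ) (c : TMConfig Q Γ) : Prop :=
  M.Reaches w c ∧ M.step c = none

/-- The machine halts on input `w`. -/
def HaltsOn (w : List Γ) : Prop := ∃ c, M.HaltsIn w c

/-- On input `w` the machine never tries to move its head to the left of the leftmost tape cell. -/
def StaysOnTape (w : List Γ) : Prop :=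
  ∀ c, M.Reaches w c → c.head = 0 →
    ∀ p b, M.delta c.state (c.tape c.head) ≠ some (p, b, Turing.Dir.left)

end TuringMachine

/-! ### Self-similar cellular automata -/

/-- A self-similar cellular automaton with finite state set `Z`. The arguments of the local rule are
`s(c_↑, t_↑)`, `s(c, t_←)`, `s(c_↙, t_↙)`, `s(c_↙, t_↘)` and `coupled(t)`. -/
structure SelfSimilarCA (Z : Type*) [Finite Z] where
  rule : Z → Z → Z → Z → Bool → Z

namespace SelfSimilarCA

variable {Z : Type*} [Finite Z]

/-- `s k i` is the state of the cell with index `k`, i.e. of the cell `[0, 2⁻ᵏ)`, during the time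
interval `2⁻ᵏ (i + [0, 1))`. The computation starts at time `0` in the configuration `C`, so that
the first state change of cell `k` occurs at time `2⁻ᵏ`. For the interval `t` with number `j + 1`
of cell `k`, the intervals `t_↑`, `t_←`, `t_↙`, `t_↘` have the numbers `⌊j / 2⌋`, `j`, `2 j`,
`2 j + 1`, and the state change at the beginning of `t` is coupled iff `j + 1` is even. -/
def IsEvolution (A : SelfSimilarCA Z) (C : ℤ → Z) (s : ℤ → ℕ → Z) : Prop :=
  (∀ k, s k 0 = C k) ∧
  ∀ k j, s k (j + 1) =
    A.rule (s (k - 1) (j / 2)) (s k j) (s (k + 1) (2 * j)) (s (k + 1) (2 * j + 1))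
      (decide (Even (j + 1)))

end SelfSimilarCA

/-- The configuration at the real time `t ≥ 0`; the unit of time is the cycle time of cell `0`. -/
noncomputable def configAt {Z : Type*} (s : ℤ → ℕ → Z) (t : ℝ) : ℤ → Z :=
  fun k => s k ⌊t * (2 : ℝ) ^ k⌋₊

/-- At time `t` the configuration is final: it does not change anymore. -/
def IsFinalAt {Z : Type*} (s : ℤ → ℕ → Z) (t : ℝ) : Prop :=
  ∀ t', t ≤ t' → configAt s t' = configAt s t

/-! ### The automaton that simulates a Turing machine -/

/-- The state set of the simulating automaton. -/
inductive SimState (Q Γ : Type*) where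
  /-- the symbol `a` -/
  | sym (a : Γ)
  /-- the symbol `a` with an arrow on top -/
  | symArrow (a : Γ)
  /-- the pair `⟨q, a⟩` -/
  | head (q : Q) (a : Γ)
  /-- the pair `⟨q, a⟩` with an arrow on top -/
  | headArrow (q : Q) (a : Γ)
  /-- the quiescent state `□` -/
  | quiet
  /-- the upgoing pulse `◀` -/
  | up
  /-- the left delimiter `◁` -/
  | leftDelim
  /-- the left delimiter with an arrow on top -/
  | leftDelimArrow
  /-- the right delimiter `▷` -/
  | rightDelim
  /-- the right delimiter with index `B` -/
  | rightDelimBlank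
  /-- the right delimiter with index `◀` -/
  | rightDelimUp

namespace SimState

variable {Q Γ : Type*}

/-- Encoding used only to see that the state set is finite. -/
def code : SimState Q Γ → Fin 11 × Option Q × Option Γ
  | sym a => (0, none, some a)
  | symArrow a => (1, none, some a)
  | head q a => (2, some q, some a)
  | headArrow q a => (3, some q, some a)
  | quiet => (4, none, none)
  | up => (5, none, none)
  | leftDelim => (6, none, none)
  | leftDelimArrow => (7, none, none)
  | rightDelim => (8, none, none)
  | rightDelimBlank => (9, none, none)
  | rightDelimUp => (10, none, none)

theorem code_injective : Function.Injective (code : SimState Q Γ → _) := by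
  intro x y h
  cases x <;> cases y <;> simp_all [code]

instance [Finite Q] [Finite Γ] : Finite (SimState Q Γ) :=
  Finite.of_injective code code_injective

/-- The tape symbol that a state carries, together with the state of the Turing machine if the
simulated head is there. Arrows are ignored. -/
def content : SimState Q Γ → Option (Γ × Option Q)
  | sym a => some (a, none)
  | symArrow a => some (a, none)
  | head q a => some (a, some q)
  | headArrow q a => some (a, some q)
  | _ => none

end SimState

namespace TuringMachine

open SimState

variable {Q Γ : Type*} (M : TuringMachine Q Γ)

/-- The block transformations `z₁ z₂ ↦ z₁' z₂'`; `none` if none is applicable. -/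
def block : SimState Q Γ → SimState Q Γ → Option (SimState Q Γ × SimState Q Γ)
  -- the pulse moves downwards
  | leftDelimArrow, head q a => some (leftDelim, headArrow q a)
  | symArrow a, sym b => some (sym a, symArrow b)
  | leftDelimArrow, sym a => some (leftDelim, symArrow a)
  | symArrow b, head q a =>
      match M.delta q a with
      | some (_, _, .right) => some (sym b, headArrow q a)
      | some (p, c, .left) => some (head p b, symArrow c)
      | none => none
  | headArrow q a, sym b =>
      match M.delta q a with
      | some (p, c, .right) => some (sym c, headArrow p b)
      | some (_, _, .left) => some (head q a, symArrow b)
      | none => none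
  | headArrow q a, rightDelim =>
      match M.delta q a with
      | some (_, _, .right) => some (head q a, rightDelimBlank)
      | some (_, _, .left) => some (head q a, rightDelimUp)
      | none => none
  | symArrow a, rightDelim => some (sym a, rightDelimUp)
  | rightDelimBlank, quiet => some (sym M.blank, rightDelimUp)
  | rightDelimUp, quiet => some (up, rightDelim)
  -- the pulse moves upwards
  | sym a, up => some (up, sym a)
  | head q a, up => some (up, head q a)
  | leftDelim, up => some (quiet, leftDelimArrow)
  | _, _ => none

/-- The local rule given by the block transformations; `x`, `y`, `z` are the states of the upper
neighbor, of the cell itself and of the lower neighbor. A cell takes part in a block transformation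
of itself and its lower neighbor at each of its state changes, and in one of its upper neighbor and
itself at each coupled state change. It keeps its state if no block transformation is applicable.
If both kinds are applicable at once, the block transformations do not determine the new state: it
is then given by the arbitrary function `amb`. -/
def simRule (amb : SimState Q Γ → SimState Q Γ → SimState Q Γ → SimState Q Γ)
    (x y z : SimState Q Γ) (coupled : Bool) : SimState Q Γ :=
  match (if coupled then M.block x y else none), M.block y z with
  | none, none => y
  | none, some (y', _) => y'
  | some (_, y'), none => y'
  | some _, some _ => amb x y z

/-- Short-circuit evaluation with regard to the quiescent state. -/
theorem simRule_quiet (amb : SimState Q Γ → SimState Q Γ → SimState Q Γ → SimState Q Γ)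
    (z : SimState Q Γ) (coupled : Bool) : M.simRule amb quiet quiet z coupled = quiet := by
  cases coupled <;> simp [simRule, block]

/-- The self-similar cellular automaton that simulates `M`. -/
def simCA [Finite Q] [Finite Γ]
    (amb : SimState Q Γ → SimState Q Γ → SimState Q Γ → SimState Q Γ) :
    SelfSimilarCA (SimState Q Γ) where
  rule := fun x y _ z coupled => M.simRule amb x y z coupled

/-- The sequence of states, starting at cell `0`, that encodes the input word. -/
def simInitWord : List Γ → List (SimState Q Γ)
  | [] => [leftDelimArrow, head M.startState M.blank, sym M.blank, rightDelim]
  | [a] => [leftDelimArrow, head M.startState a, sym M.blank, rightDelim]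
  | a :: b :: w =>
      [leftDelimArrow, head M.startState a] ++ (b :: w).map sym ++ [rightDelim]

/-- The initial configuration `C₀(w)`; all other cells are quiescent. -/
def simInit (w : List Γ) : ℤ → SimState Q Γ
  | .ofNat k => (M.simInitWord w).getD k quiet
  | .negSucc _ => quiet

/-- The configuration `C` has the form `… □ □ ◁ z₀ … zₙ₋₁ ▷ □ □ …`, where `z₀ … zₙ₋₁` (up to arrows)
are the first `n` tape cells of the Turing machine configuration `c`, with the state of `c` attached
at the head position, and all further tape cells of `c` are blank. -/
def HeldBetweenDelimiters (c : TMConfig Q Γ) (C : ℤ → SimState Q Γ) : Prop :=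
  ∃ m n : ℕ, c.head < n ∧
    C m = leftDelim ∧ C (m + n + 1) = rightDelim ∧
    (∀ j : ℕ, j < n →
      (C (m + 1 + j)).content = some (c.tape j, if j = c.head then some c.state else none)) ∧
    (∀ j : ℕ, n ≤ j → c.tape j = M.blank) ∧
    ∀ k : ℤ, k < m ∨ (m + n + 1 : ℤ) < k → C k = quiet

end TuringMachine

/-!
At every time at most one pair of neighboring cells `p`, `p + 1` admits a block transformation,
namely the pair at the pulse. This transformation takes place at the first tick of cell `p` after
the previous transformation, and nothing else ever changes. The evolution is therefore a sequence of
events (`IsEventSequence`), described without reference to the local rule at each tick of each cell;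
`IsEventSequence.isEvolution` shows that it obeys this rule.

The simulation is a sequence of stages (`Stage`, `Stage.Next`). In one pass, the pulse starts as
`◁` with an arrow in cell `m`, moves downwards and lets the Turing machine move whenever it meets
the head suitably, turns at the right delimiter, after appending a blank tape cell if the head waits
there for one, and returns as `◀`, by which the whole pattern is shifted to the cells from `m + 1`
on. The way down is a geometric series of cycles, and on the way up the pulse is synchronized by the
clocks of the cells, so that the pass takes the time `3 · 2⁻ᵐ` however long the tape is; it begins
at time `6 - 6 · 2⁻ᵐ`. `Stage.Next.isEvent` checks that stages follow one another by events.

The pulse can only get stuck at the head of a Turing machine that has halted. Conversely, if the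
Turing machine halts, the pulse gets stuck (`exists_stuck_of_haltsOn`), because the Turing machine
makes a move in at least one of two consecutive passes; the configuration is final then. If the
Turing machine does not halt, there are infinitely many passes, the pattern leaves every cell before
time `6`, and some cell is not quiescent at any earlier time.

A cell depends on its lower neighbor at a time that is later in its cycle, and so on downwards, so
that the recursion defining the evolution is not well-founded. Uniqueness holds since a quiescent
cell does not depend on its lower neighbor: before the limit of the events only finitely many cells
have ever been active (`IsEventSequence.eq_of_quiet_below`), and after it all cells are quiescent
(`IsVanishing`).
-/

namespace TuringMachine

open SimState

/-! ### Clocks -/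

/-- The length of a cycle of cell `k`, in cycles of cell `0`. -/
noncomputable def cycle (k : ℤ) : ℝ := (2 : ℝ) ^ (-k)

theorem cycle_pos (k : ℤ) : 0 < cycle k := by unfold cycle; positivity

theorem cycle_eq_two_mul (k : ℤ) : cycle k = 2 * cycle (k + 1) := by
  unfold cycle
  rw [neg_add, zpow_add₀ two_ne_zero, zpow_neg_one]
  ring

theorem cycle_pred (k : ℤ) : cycle (k - 1) = 2 * cycle k := by
  simpa using cycle_eq_two_mul (k - 1)

/-- Cell `k` may change its state at time `t`. -/
def IsTick (k : ℤ) (t : ℝ) : Prop := ∃ N : ℤ, t = N * cycle k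

theorem IsTick.succ {k : ℤ} {t : ℝ} (h : IsTick k t) : IsTick (k + 1) t := by
  obtain ⟨N, rfl⟩ := h
  exact ⟨2 * N, by rw [cycle_eq_two_mul]; push_cast; ring⟩

theorem not_isTick_of_between {k : ℤ} {j : ℕ} {t : ℝ} (h₁ : j * cycle k < t)
    (h₂ : t < (j + 1) * cycle k) : ¬ IsTick k t := by
  rintro ⟨N, rfl⟩
  have hk := cycle_pos k
  have h₁' : ((j : ℤ) : ℝ) < N := by
    rw [Int.cast_natCast]; exact lt_of_mul_lt_mul_right h₁ hk.le
  have h₂' : (N : ℝ) < ((j + 1 : ℤ) : ℝ) := by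
    push_cast; exact lt_of_mul_lt_mul_right h₂ hk.le
  rw [Int.cast_lt] at h₁' h₂'
  omega

variable {Q Γ : Type*} {M : TuringMachine Q Γ}

/-! ### The local rule -/

@[simp] theorem block_quiet_left (z : SimState Q Γ) : M.block quiet z = none := by
  cases z <;> rfl

/-- A quiescent cell does not depend on its lower neighbor. -/
theorem simRule_quiet_congr (amb : SimState Q Γ → SimState Q Γ → SimState Q Γ → SimState Q Γ)
    (x z z' : SimState Q Γ) (b : Bool) :
    M.simRule amb x quiet z b = M.simRule amb x quiet z' b := by
  simp only [simRule, block_quiet_left]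
  generalize (if b = true then M.block x quiet else none) = o
  cases o <;> rfl

/-! ### Event sequences -/

/-- The configuration `C`, present from time `t` on, has `(p, p + 1)` as its only pair of cells to
which a block transformation is applicable; the transformation takes place at `t'`, the first time
after `t` at which cell `p` may change, and leads to `C'`. -/
structure IsEvent (M : TuringMachine Q Γ) (p : ℤ) (C C' : ℤ → SimState Q Γ) (t t' : ℝ) : Prop where
  lt : t < t'
  le : t' ≤ t + cycle p
  tick : IsTick p t'
  block_eq : M.block (C p) (C (p + 1)) = some (C' p, C' (p + 1))
  block_none : ∀ k, k ≠ p → M.block (C k) (C (k + 1)) = none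
  eq : ∀ k, k ≠ p → k ≠ p + 1 → C' k = C k

/-- The configurations `C i` follow one another by events at the times `τ (i + 1)`. A configuration
to which no block transformation is applicable is repeated forever; the times of the repetitions
are irrelevant. -/
structure IsEventSequence (M : TuringMachine Q Γ) (C : ℕ → ℤ → SimState Q Γ) (τ : ℕ → ℝ) :
    Prop where
  zero : τ 0 = 0
  lt : ∀ i, τ i < τ (i + 1)
  event : ∀ i, (∃ p, IsEvent M p (C i) (C (i + 1)) (τ i) (τ (i + 1))) ∨
    ((∀ k, M.block (C i k) (C i (k + 1)) = none) ∧ C (i + 1) = C i)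

open Classical in
/-- The configuration at time `t`. From the supremum of the times of events on, all cells are
taken to be quiescent. -/
noncomputable def stateAt (C : ℕ → ℤ → SimState Q Γ) (τ : ℕ → ℝ) (t : ℝ) : ℤ → SimState Q Γ :=
  if h : ∃ i, t < τ (i + 1) then C (Nat.find h) else fun _ => quiet

/-- The state of cell `k` during its cycle number `j`. -/
noncomputable def eventStates (C : ℕ → ℤ → SimState Q Γ) (τ : ℕ → ℝ) (k : ℤ) (j : ℕ) :
    SimState Q Γ :=
  stateAt C τ (j * cycle k) k

/-- If the times of events are bounded, each cell is quiescent from one cycle of its own before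
their supremum on. -/
def IsVanishing (C : ℕ → ℤ → SimState Q Γ) (τ : ℕ → ℝ) : Prop :=
  ∀ k t u, 0 ≤ t → t ≤ u → u ≤ t + cycle k → (∀ i, τ i ≤ u) → stateAt C τ t k = quiet

theorem stateAt_of_forall_le {C : ℕ → ℤ → SimState Q Γ} {τ : ℕ → ℝ} {t : ℝ} (h : ∀ i, τ i ≤ t) :
    stateAt C τ t = fun _ => quiet := by
  rw [stateAt, dif_neg]
  rintro ⟨i, hi⟩
  exact absurd (h (i + 1)) (not_le.2 hi)

namespace IsEventSequence

variable {C : ℕ → ℤ → SimState Q Γ} {τ : ℕ → ℝ}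

theorem strictMono (E : IsEventSequence M C τ) : StrictMono τ := strictMono_nat_of_lt_succ E.lt

theorem nonneg (E : IsEventSequence M C τ) (i : ℕ) : 0 ≤ τ i := by
  rw [← E.zero]; exact E.strictMono.monotone (Nat.zero_le i)

theorem exists_index (E : IsEventSequence M C τ) {t : ℝ} (ht : 0 ≤ t) {n : ℕ} (h : t < τ n) :
    ∃ i < n, τ i ≤ t ∧ t < τ (i + 1) := by
  induction n with
  | zero => rw [E.zero] at h; exact absurd ht (not_le.2 h)
  | succ n ih =>
    rcases lt_or_ge t (τ n) with h' | h'
    · obtain ⟨i, hi, hh⟩ := ih h'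
      exact ⟨i, by omega, hh⟩
    · exact ⟨n, by omega, h', h⟩

theorem exists_index_left (E : IsEventSequence M C τ) {t : ℝ} (ht : 0 < t) {n : ℕ} (h : t ≤ τ n) :
    ∃ i, τ i < t ∧ t ≤ τ (i + 1) := by
  induction n with
  | zero => rw [E.zero] at h; exact absurd ht (not_lt.2 h)
  | succ n ih =>
    rcases le_or_gt t (τ n) with h' | h'
    · exact ih h'
    · exact ⟨n, h', h⟩

theorem stateAt_eq (E : IsEventSequence M C τ) {t : ℝ} {i : ℕ} (h₁ : τ i ≤ t) (h₂ : t < τ (i + 1)) :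
    stateAt C τ t = C i := by
  classical
  have h : ∃ i, t < τ (i + 1) := ⟨i, h₂⟩
  rw [stateAt, dif_pos h]
  congr 1
  rw [Nat.find_eq_iff]
  refine ⟨h₂, fun n hn => not_lt.2 (le_trans (E.strictMono.monotone ?_) h₁)⟩
  omega

theorem isTick_of_ne (E : IsEventSequence M C τ) {i : ℕ} {k : ℤ} (h : C (i + 1) k ≠ C i k) :
    IsTick k (τ (i + 1)) := by
  rcases E.event i with ⟨p, hp⟩ | ⟨-, h'⟩
  · by_cases h₁ : k = p
    · exact h₁ ▸ hp.tick
    · by_cases h₂ : k = p + 1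
      · exact h₂ ▸ hp.tick.succ
      · exact absurd (hp.eq k h₁ h₂) h
  · rw [h'] at h; exact absurd rfl h

/-- A cell keeps its state between two of its ticks. -/
theorem stateAt_congr (E : IsEventSequence M C τ) {k : ℤ} {j : ℕ} {a b : ℝ}
    (h₁ : j * cycle k ≤ a) (h₂ : a ≤ b) (h₃ : b < (j + 1) * cycle k) {n : ℕ} (hn : b < τ n) :
    stateAt C τ a k = stateAt C τ b k := by
  have ha : 0 ≤ a := le_trans (mul_nonneg (Nat.cast_nonneg j) (cycle_pos k).le) h₁
  obtain ⟨ia, -, ha₁, ha₂⟩ := E.exists_index ha (h₂.trans_lt hn)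
  obtain ⟨ib, -, hb₁, hb₂⟩ := E.exists_index (ha.trans h₂) hn
  rw [E.stateAt_eq ha₁ ha₂, E.stateAt_eq hb₁ hb₂]
  have hab : ia ≤ ib := by
    have := E.strictMono.lt_iff_lt.1 ((ha₁.trans h₂).trans_lt hb₂)
    omega
  have key : ∀ d, ia + d ≤ ib → C (ia + d) k = C ia k := by
    intro d
    induction d with
    | zero => intro _; rfl
    | succ d ih =>
      intro hd
      rw [← ih (by omega)]
      by_contra hne
      refine not_isTick_of_between (j := j) ?_ ?_ (E.isTick_of_ne hne)
      · have hle : ia + 1 ≤ ia + d + 1 := by omega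
        exact h₁.trans_lt (ha₂.trans_le (E.strictMono.monotone hle))
      · have hle : ia + d + 1 ≤ ib := by omega
        exact lt_of_le_of_lt (le_trans (E.strictMono.monotone hle) hb₁) h₃
  rw [← key (ib - ia) (by omega)]
  congr 1
  omega

/-- Just before its tick number `j + 1`, cell `k` is in the state taken on at tick number `j`. -/
theorem eventStates_eq (E : IsEventSequence M C τ) {k : ℤ} {j i : ℕ}
    (h₁ : τ i < (j + 1) * cycle k) (h₂ : (j + 1) * cycle k ≤ τ (i + 1)) :
    eventStates C τ k j = C i k := by
  have hk := cycle_pos k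
  have hb : max (τ i) (j * cycle k) < (j + 1) * cycle k := max_lt h₁ (by linarith)
  rw [eventStates, E.stateAt_congr le_rfl (le_max_right _ _) hb (hb.trans_le h₂),
    E.stateAt_eq (le_max_left _ _) (hb.trans_le h₂)]

theorem eventStates_zero (E : IsEventSequence M C τ) (k : ℤ) : eventStates C τ k 0 = C 0 k := by
  rw [eventStates, E.stateAt_eq (i := 0)] <;> simp [E.zero]
  simpa [E.zero] using E.lt 0

/-- As long as the events continue, the state changes obey the local rule: at a tick of cell `k`
a block transformation is applicable to `k` and one of its neighbors only if this tick is the time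
of the next event. -/
theorem eventStates_succ_of_le [Finite Q] [Finite Γ] (E : IsEventSequence M C τ)
    (amb : SimState Q Γ → SimState Q Γ → SimState Q Γ → SimState Q Γ) {k : ℤ} {j i : ℕ}
    (h₁ : τ i < (j + 1) * cycle k) (h₂ : (j + 1) * cycle k ≤ τ (i + 1)) :
    eventStates C τ k (j + 1) = M.simRule amb (eventStates C τ (k - 1) (j / 2))
      (eventStates C τ k j) (eventStates C τ (k + 1) (2 * j + 1)) (decide (Even (j + 1))) := by
  have hk := cycle_pos k
  have hsucc := cycle_eq_two_mul k
  have hpred := cycle_pred k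
  have hz : ((2 * j + 1 : ℕ) + 1 : ℝ) * cycle (k + 1) = (j + 1) * cycle k := by
    rw [hsucc]; push_cast; ring
  have hx : Even (j + 1) → ((j / 2 : ℕ) + 1 : ℝ) * cycle (k - 1) = (j + 1) * cycle k := by
    rintro ⟨l, hl⟩
    obtain ⟨r, rfl⟩ : ∃ r, j = 2 * r + 1 := ⟨l - 1, by omega⟩
    have : (2 * r + 1) / 2 = r := by omega
    rw [this, hpred]; push_cast; ring
  have htick : IsTick k ((j + 1) * cycle k) := ⟨j + 1, by push_cast; rfl⟩
  have heven : IsTick (k - 1) ((j + 1) * cycle k) → Even (j + 1) := by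
    rintro ⟨N, hN⟩
    rw [hpred, ← mul_assoc] at hN
    have := mul_right_cancel₀ hk.ne' hN
    have h' : ((j + 1 : ℕ) : ℤ) = N * 2 := by exact_mod_cast this
    exact (Int.even_coe_nat _).1 (h' ▸ even_two.mul_left N)
  rw [E.eventStates_eq h₁ h₂, E.eventStates_eq (k := k + 1) (hz ▸ h₁) (hz ▸ h₂)]
  have hxx : (if decide (Even (j + 1)) = true then
      M.block (eventStates C τ (k - 1) (j / 2)) (C i k) else none) =
      if Even (j + 1) then M.block (C i (k - 1)) (C i k) else none := by
    by_cases he : Even (j + 1)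
    · rw [E.eventStates_eq (hx he ▸ h₁) (hx he ▸ h₂)]
      simp [he]
    · simp [he]
  have hres : eventStates C τ k (j + 1) =
      if (j + 1) * cycle k = τ (i + 1) then C (i + 1) k else C i k := by
    rw [eventStates]
    push_cast
    split_ifs with h
    · rw [E.stateAt_eq h.ge (h ▸ E.lt (i + 1))]
    · rw [E.stateAt_eq h₁.le (lt_of_le_of_ne h₂ h)]
  rw [hres, simRule, hxx]
  rcases E.event i with ⟨p, hp⟩ | ⟨hnone, hC⟩
  · by_cases hkp : k = p
    · subst hkp
      -- the event takes place at the first tick of cell `p` after `τ i`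
      have hu : (j + 1) * cycle k = τ (i + 1) := by
        by_contra hne
        obtain ⟨N, hN⟩ := hp.tick
        have h₃ := lt_of_le_of_ne h₂ hne
        have h₄ := hp.le
        rw [hN] at h₃ h₄
        have h₅ : (N : ℝ) * cycle k < (j + 1 + 1) * cycle k := by linarith
        have h₃' : ((j + 1 : ℤ) : ℝ) < N := by
          push_cast; exact lt_of_mul_lt_mul_right h₃ hk.le
        have h₅' : (N : ℝ) < ((j + 1 + 1 : ℤ) : ℝ) := by
          push_cast; exact lt_of_mul_lt_mul_right h₅ hk.le
        rw [Int.cast_lt] at h₃' h₅'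
        omega
      have hb := hp.block_none (k - 1) (by omega)
      rw [sub_add_cancel] at hb
      rw [if_pos hu, hb, hp.block_eq]
      simp
    · have hb := hp.block_none k hkp
      rw [hb]
      by_cases hkp' : k = p + 1
      · subst hkp'
        rw [add_sub_cancel_right] at *
        rw [hp.block_eq]
        by_cases hu : (j + 1) * cycle (p + 1) = τ (i + 1)
        · rw [if_pos hu, if_pos (heven (hu ▸ hp.tick))]
        · rw [if_neg hu, if_neg]
          intro he
          obtain ⟨N, hN⟩ := hp.tick
          have h₃ := lt_of_le_of_ne h₂ hu
          have h₄ := hp.le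
          have hc := cycle_pos p
          rw [← hx he] at h₁ h₃
          rw [hN] at h₃ h₄
          have h₅ : (N : ℝ) * cycle p < ((j / 2 : ℕ) + 1 + 1) * cycle p := by linarith
          have h₃' : (((j / 2 : ℕ) + 1 : ℤ) : ℝ) < N := by
            push_cast [-Nat.cast_div_charZero, -Nat.cast_ofNat]
            exact lt_of_mul_lt_mul_right h₃ hc.le
          have h₅' : (N : ℝ) < (((j / 2 : ℕ) + 1 + 1 : ℤ) : ℝ) := by
            push_cast; exact lt_of_mul_lt_mul_right h₅ hc.le
          rw [Int.cast_lt] at h₃' h₅'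
          omega
      · have hb' := hp.block_none (k - 1) (by omega)
        rw [sub_add_cancel] at hb'
        rw [hb', hp.eq k hkp hkp']
        simp
  · have hb := hnone k
    have hb' := hnone (k - 1)
    rw [sub_add_cancel] at hb'
    rw [hb, hb', hC]
    simp

theorem isEvolution [Finite Q] [Finite Γ] (E : IsEventSequence M C τ) (hC : IsVanishing C τ)
    (amb : SimState Q Γ → SimState Q Γ → SimState Q Γ → SimState Q Γ) :
    (M.simCA amb).IsEvolution (C 0) (eventStates C τ) := by
  refine ⟨E.eventStates_zero, fun k j => ?_⟩
  change _ = M.simRule amb _ _ _ _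
  have hk := cycle_pos k
  have h0 : 0 ≤ (j : ℝ) * cycle k := by positivity
  by_cases h : ∃ i, (j + 1) * cycle k ≤ τ i
  · obtain ⟨i, hi⟩ := h
    obtain ⟨i, h₁, h₂⟩ := E.exists_index_left (by positivity) hi
    exact E.eventStates_succ_of_le amb h₁ h₂
  · push Not at h
    -- after all events, cell `k` and, at a coupled state change, its upper neighbor are quiescent
    have hy : eventStates C τ k j = quiet :=
      hC k _ ((j + 1) * cycle k) h0 (by linarith) (by linarith) fun i => (h i).le
    have hx : Even (j + 1) → eventStates C τ (k - 1) (j / 2) = quiet := by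
      rintro ⟨l, hl⟩
      obtain ⟨r, rfl⟩ : ∃ r, j = 2 * r + 1 := ⟨l - 1, by omega⟩
      have hr : (2 * r + 1) / 2 = r := by omega
      have hpred := cycle_pred k
      have hr0 : (0 : ℝ) ≤ r * cycle (k - 1) := mul_nonneg (Nat.cast_nonneg r) (cycle_pos _).le
      rw [hr]
      refine hC (k - 1) _ (((2 * r + 1 : ℕ) + 1) * cycle k) hr0 ?_ ?_ fun i => (h i).le
      · rw [hpred]; push_cast; linarith
      · rw [hpred]; push_cast; linarith
    have hres : eventStates C τ k (j + 1) = quiet := by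
      rw [eventStates, stateAt_of_forall_le]
      intro i; push_cast; exact (h i).le
    rw [hres, hy, simRule]
    by_cases he : Even (j + 1)
    · simp [hx he]
    · simp [he]

theorem configAt_eventStates (E : IsEventSequence M C τ) (hC : IsVanishing C τ) {t : ℝ}
    (ht : 0 ≤ t) : configAt (eventStates C τ) t = stateAt C τ t := by
  funext k
  have hk := cycle_pos k
  have h2 : (2 : ℝ) ^ k * cycle k = 1 := by
    rw [cycle, ← zpow_add₀ two_ne_zero]; simp
  have ht2 : 0 ≤ t * (2 : ℝ) ^ k := by positivity
  have hmul : t * (2 : ℝ) ^ k * cycle k = t := by rw [mul_assoc, h2, mul_one]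
  have h₁ : (⌊t * (2 : ℝ) ^ k⌋₊ : ℝ) * cycle k ≤ t := by
    calc _ ≤ t * (2 : ℝ) ^ k * cycle k := mul_le_mul_of_nonneg_right (Nat.floor_le ht2) hk.le
      _ = t := hmul
  have h₂ : t < (⌊t * (2 : ℝ) ^ k⌋₊ + 1 : ℝ) * cycle k := by
    calc t = t * (2 : ℝ) ^ k * cycle k := hmul.symm
      _ < _ := mul_lt_mul_of_pos_right (Nat.lt_floor_add_one _) hk
  rw [configAt, eventStates]
  by_cases h : ∃ i, t < τ i
  · obtain ⟨i, hi⟩ := h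
    exact E.stateAt_congr le_rfl h₁ h₂ hi
  · push Not at h
    rw [stateAt_of_forall_le h]
    exact hC k _ t (by positivity) h₁ (by linarith) h

/-- As long as only finitely many cells have left the quiescent state, the evolution is determined,
since a quiescent cell does not depend on its lower neighbor. In units of the cycle of a cell `K`
below which all cells are quiescent, the ticks of the cells up to `K` have natural numbers as their
times; the proof is by induction on them. -/
theorem eq_of_quiet_below [Finite Q] [Finite Γ]
    {amb : SimState Q Γ → SimState Q Γ → SimState Q Γ → SimState Q Γ}
    {C₀ : ℤ → SimState Q Γ} {s s' : ℤ → ℕ → SimState Q Γ}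
    (hs : (M.simCA amb).IsEvolution C₀ s) (hs' : (M.simCA amb).IsEvolution C₀ s') {b : ℝ} {K : ℤ}
    (hK : ∀ (k : ℤ) (j : ℕ), K ≤ k → j * cycle k < b → s k j = quiet) {k : ℤ} {j : ℕ}
    (hb : j * cycle k < b) : s' k j = s k j := by
  -- `K` may be replaced by any larger number
  wlog hkK : k ≤ K generalizing K
  · exact this (K := k) (fun k' j' h => hK k' j' (by omega)) le_rfl
  obtain ⟨d, rfl⟩ : ∃ d : ℕ, k = K - d := ⟨(K - k).toNat, by omega⟩
  clear hkK
  induction hN : j * 2 ^ d using Nat.strong_induction_on generalizing j d with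
  | _ N ih =>
    subst hN
    rcases j with _ | j
    · rw [hs.1, hs'.1]
    have hd : 0 < 2 ^ d := by positivity
    have hk := cycle_pos (K - d)
    push_cast at hb
    have e₁ : s' (K - d) j = s (K - d) j :=
      ih _ (by nlinarith) d (by linarith) rfl
    have e₂ : s' (K - d - 1) (j / 2) = s (K - d - 1) (j / 2) := by
      have hj : j / 2 * 2 ≤ j := Nat.div_mul_le_self j 2
      have hj' : ((j / 2 : ℕ) : ℝ) * 2 ≤ j := by exact_mod_cast hj
      have hc := cycle_pred (K - d)
      have hd1 : K - d - 1 = K - (d + 1 : ℕ) := by push_cast; ring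
      have := ih (j / 2 * 2 ^ (d + 1)) (by rw [pow_succ]; nlinarith) (d + 1) (j := j / 2) ?_ rfl
      · rwa [hd1]
      · rw [← hd1, hc]; nlinarith
    rw [hs.2, hs'.2]
    change M.simRule amb _ _ _ _ = M.simRule amb _ _ _ _
    rw [e₁, e₂]
    rcases d with _ | d
    · rw [hK (K - (0 : ℕ)) j (by simp) (by linarith)]
      exact simRule_quiet_congr _ _ _ _ _
    · have hd1 : K - (d + 1 : ℕ) + 1 = K - d := by push_cast; ring
      have hc := cycle_eq_two_mul (K - (d + 1 : ℕ))
      rw [hd1] at hc ⊢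
      have := cycle_pos (K - d)
      rw [ih ((2 * j + 1) * 2 ^ d) (by rw [pow_succ]; nlinarith [pow_pos (two_pos (α := ℕ)) d]) d
        (by push_cast; nlinarith) rfl]

/-- The evolution is unique. Before the limit of the events this is `eq_of_quiet_below`; at later
times each cell is quiescent just before its state change, so that its lower neighbor does not
matter. -/
theorem evolution_unique [Finite Q] [Finite Γ] (E : IsEventSequence M C τ) (hC : IsVanishing C τ)
    (hfin : ∀ i, ∃ K : ℤ, ∀ k, K ≤ k → C i k = quiet)
    {amb : SimState Q Γ → SimState Q Γ → SimState Q Γ → SimState Q Γ}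
    {s : ℤ → ℕ → SimState Q Γ} (hs : (M.simCA amb).IsEvolution (C 0) s) :
    s = eventStates C τ := by
  have hev := E.isEvolution hC amb
  have hfin' : ∀ n, ∃ K : ℤ, ∀ i < n, ∀ k, K ≤ k → C i k = quiet := by
    intro n
    induction n with
    | zero => exact ⟨0, fun i hi => absurd hi (Nat.not_lt_zero i)⟩
    | succ n ih =>
      obtain ⟨K, hK⟩ := ih
      obtain ⟨L, hL⟩ := hfin n
      refine ⟨max K L, fun i hi k hk => ?_⟩
      rcases Nat.lt_succ_iff_lt_or_eq.1 hi with h | rfl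
      · exact hK i h k (le_trans (le_max_left _ _) hk)
      · exact hL k (le_trans (le_max_right _ _) hk)
  funext k j
  induction j using Nat.strong_induction_on generalizing k with
  | _ j ih =>
    have hk := cycle_pos k
    by_cases h : ∃ n, j * cycle k < τ n
    · obtain ⟨n, hn⟩ := h
      obtain ⟨K, hK⟩ := hfin' n
      refine eq_of_quiet_below hev hs (b := τ n) (K := K) (fun k' j' hk' hj' => ?_) hn
      have := cycle_pos k'
      obtain ⟨i, hi, h₁, h₂⟩ := E.exists_index (by positivity) hj'
      rw [eventStates, E.stateAt_eq h₁ h₂]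
      exact hK i hi k' hk'
    · push Not at h
      rcases j with _ | j
      · rw [hs.1, hev.1]
      · push_cast at h
        have hy : eventStates C τ k j = quiet :=
          hC k _ ((j + 1) * cycle k) (by positivity) (by linarith) (by linarith) h
        rw [hs.2, hev.2]
        change M.simRule amb _ _ _ _ = M.simRule amb _ _ _ _
        rw [ih j (by omega), ih (j / 2) (by omega), hy]
        exact simRule_quiet_congr _ _ _ _ _

end IsEventSequence

/-! ### Stages of the simulation -/

/-- The position of the pulse. The number in `down i` and `up i` is the distance from the cell that
holds `◁` to the cell that holds the pulse. -/
inductive Phase where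
  /-- the pulse moves downwards: an arrow -/
  | down (i : ℕ)
  /-- the pulse is at the right delimiter, which is `▷_B` -/
  | delimBlank
  /-- the pulse is at the right delimiter, which is `▷_◀` -/
  | delimUp
  /-- the pulse moves upwards: the state `◀` -/
  | up (i : ℕ)

/-- A stage of the simulation: the left delimiter is in cell `offset`, and the first `size` tape
cells of the Turing machine configuration `config` lie between the delimiters. -/
structure Stage (Q Γ : Type*) where
  offset : ℕ
  size : ℕ
  config : TMConfig Q Γ
  phase : Phase

/-- The state that represents the tape cell `j` of the Turing machine configuration `c`. -/
def tapeState (c : TMConfig Q Γ) (j : ℕ) : SimState Q Γ :=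
  if j = c.head then head c.state (c.tape j) else sym (c.tape j)

/-- Put an arrow on top. -/
def addArrow : SimState Q Γ → SimState Q Γ
  | sym a => symArrow a
  | head q a => headArrow q a
  | leftDelim => leftDelimArrow
  | z => z

/-- The states `◁ z₀ … zₙ₋₁ ▷ □ □ …` without a pulse. -/
def frame (n : ℕ) (c : TMConfig Q Γ) (i : ℕ) : SimState Q Γ :=
  if i = 0 then leftDelim else if i ≤ n then tapeState c (i - 1) else
    if i = n + 1 then rightDelim else quiet

/-- The states of the cells from the cell of the left delimiter on. -/
def phaseStates (n : ℕ) (c : TMConfig Q Γ) : Phase → ℕ → SimState Q Γ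
  | .down l, i => if i = l then addArrow (frame n c i) else frame n c i
  | .delimBlank, i => if i = n + 1 then rightDelimBlank else frame n c i
  | .delimUp, i => if i = n + 1 then rightDelimUp else frame n c i
  | .up l, i => if i < l then frame n c i else if i = l then up else frame n c (i - 1)

/-- The sequence of states `r`, written from cell `m` on. -/
def placeAt (m : ℕ) (r : ℕ → SimState Q Γ) (k : ℤ) : SimState Q Γ :=
  if k < m then quiet else r (k - m).toNat

/-- The configuration of the automaton at a stage. -/
def Stage.cells (S : Stage Q Γ) : ℤ → SimState Q Γ :=
  placeAt S.offset (phaseStates S.size S.config S.phase)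

/-- The time at which a stage is reached. A pass that begins at cell `m` begins at time
`6 - 6 · 2⁻ᵐ`. The pulse then moves from cell `m + j` to cell `m + j + 1` within one cycle of cell
`m + j`, so that it would be at infinity at time `6 - 4 · 2⁻ᵐ`. It turns earlier and, since a
transformation of the cells `m + i` and `m + i + 1` has to wait for the clock of cell `m + i`, is at
cell `m + size` at exactly this time, whatever the size. It reaches each cell `m + i` with
`i < size` on its way upwards one cycle of this cell later. -/
noncomputable def Stage.time (S : Stage Q Γ) : ℝ :=
  6 - 4 * cycle S.offset + match S.phase with
    | .down i => - (2 * cycle (S.offset + i : ℕ))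
    | .delimBlank => - cycle (S.offset + S.size : ℕ)
    | .delimUp => - cycle (S.offset + S.size : ℕ)
    | .up i => if i = S.size + 1 then - cycle (S.offset + i : ℕ) else
        if i = S.size then 0 else cycle (S.offset + i : ℕ)

/-- The conditions on a stage that hold throughout the simulation. -/
structure Stage.Valid (M : TuringMachine Q Γ) (w : List Γ) (S : Stage Q Γ) : Prop where
  two_le : 2 ≤ S.size
  head_lt : S.config.head < S.size
  blank : ∀ j, S.size ≤ j → S.config.tape j = M.blank
  reaches : M.Reaches w S.config
  phase : match S.phase with
    | .down i => i ≤ S.size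
    | .up i => 1 ≤ i ∧ i ≤ S.size + 1
    | _ => True

/-- The direction of the next move of the Turing machine. -/
def dir (M : TuringMachine Q Γ) (c : TMConfig Q Γ) : Option Turing.Dir :=
  (M.delta c.state (c.tape c.head)).map fun x => x.2.2

/-- A stage is followed by another one. The Turing machine moves to the left when the pulse, on its
way downwards, is just above the head, and to the right when the pulse is at the head. -/
inductive Stage.Next (M : TuringMachine Q Γ) : Stage Q Γ → Stage Q Γ → Prop
  | pass {m n c i} : i < n → (i = c.head → 0 < i → M.dir c = some .right) →
      (i = c.head + 1 → M.dir c = some .left) →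
      Next M ⟨m, n, c, .down i⟩ ⟨m, n, c, .down (i + 1)⟩
  | moveLeft {m n q h T p b} : h + 1 < n → M.delta q (T (h + 1)) = some (p, b, .left) →
      Next M ⟨m, n, ⟨q, h + 1, T⟩, .down (h + 1)⟩
        ⟨m, n, ⟨p, h, Function.update T (h + 1) b⟩, .down (h + 2)⟩
  | moveRight {m n q h T p b} : h + 1 < n → M.delta q (T h) = some (p, b, .right) →
      Next M ⟨m, n, ⟨q, h, T⟩, .down (h + 1)⟩
        ⟨m, n, ⟨p, h + 1, Function.update T h b⟩, .down (h + 2)⟩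
  | reachDelim {m n c} : (n = c.head + 1 → M.dir c = some .left) →
      Next M ⟨m, n, c, .down n⟩ ⟨m, n, c, .delimUp⟩
  | reachDelimBlank {m n c} : n = c.head + 1 → M.dir c = some .right →
      Next M ⟨m, n, c, .down n⟩ ⟨m, n, c, .delimBlank⟩
  | extend {m n c} : Next M ⟨m, n, c, .delimBlank⟩ ⟨m, n + 1, c, .delimUp⟩
  | turn {m n c} : Next M ⟨m, n, c, .delimUp⟩ ⟨m, n, c, .up (n + 1)⟩
  | rise {m n c i} : 1 ≤ i → Next M ⟨m, n, c, .up (i + 1)⟩ ⟨m, n, c, .up i⟩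
  | restart {m n c} : Next M ⟨m, n, c, .up 1⟩ ⟨m + 1, n, c, .down 0⟩

/-- A stage at which the pulse is stuck, as the Turing machine has halted. -/
inductive Stage.Stuck (M : TuringMachine Q Γ) : Stage Q Γ → Prop
  | intro {m n c i} : 0 < i → i = c.head ∨ i = c.head + 1 →
      M.delta c.state (c.tape c.head) = none → Stuck M ⟨m, n, c, .down i⟩

theorem Stage.Valid.stuck_or_next {w : List Γ} {S : Stage Q Γ} (hS : S.Valid M w) :
    S.Stuck M ∨ ∃ S', S.Next M S' := by
  obtain ⟨m, n, c, ph⟩ := S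
  have h2 := hS.two_le
  have hh := hS.head_lt
  have hp := hS.phase
  rcases ph with i | _ | _ | i
  · simp only at h2 hh hp
    rcases hδ : M.delta c.state (c.tape c.head) with _ | ⟨p, b, d⟩
    · by_cases hi : 0 < i ∧ (i = c.head ∨ i = c.head + 1)
      · exact .inl (.intro hi.1 hi.2 hδ)
      · right
        rcases hp.lt_or_eq with hlt | rfl
        · exact ⟨_, .pass hlt (fun h h' => by omega) (fun h => by omega)⟩
        · exact ⟨_, .reachDelim (fun h => by omega)⟩
    · right
      have hd : M.dir c = some d := by rw [dir, hδ]; rfl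
      rcases hp.lt_or_eq with hlt | rfl
      · rcases d with _ | _
        · by_cases hi : 0 < i ∧ i = c.head
          · obtain ⟨q, h, T⟩ := c
            obtain ⟨hi, rfl⟩ := hi
            obtain ⟨h, rfl⟩ : ∃ h, i = h + 1 := ⟨i - 1, by omega⟩
            exact ⟨_, .moveLeft hlt hδ⟩
          · exact ⟨_, .pass hlt (fun h h' => by omega) (fun _ => hd)⟩
        · by_cases hi : i = c.head + 1
          · obtain ⟨q, h, T⟩ := c
            subst hi
            exact ⟨_, .moveRight hlt hδ⟩
          · exact ⟨_, .pass hlt (fun _ _ => hd) (fun h => by omega)⟩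
      · rcases d with _ | _
        · exact ⟨_, .reachDelim fun _ => hd⟩
        · by_cases hi : i = c.head + 1
          · exact ⟨_, .reachDelimBlank hi hd⟩
          · exact ⟨_, .reachDelim fun h => by omega⟩
  · exact .inr ⟨_, .extend⟩
  · exact .inr ⟨_, .turn⟩
  · obtain ⟨hi, -⟩ : 1 ≤ i ∧ i ≤ n + 1 := hp
    rcases hi.lt_or_eq with h | rfl
    · obtain ⟨j, rfl⟩ : ∃ j, i = j + 1 := ⟨i - 1, by omega⟩
      exact .inr ⟨_, .rise (by omega)⟩
    · exact .inr ⟨_, .restart⟩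

/-- From a stage to the next one, the Turing machine makes at most one move. -/
theorem Stage.Next.step_or_eq {S S' : Stage Q Γ} (h : S.Next M S') :
    M.step S.config = some S'.config ∨ S'.config = S.config := by
  cases h with
  | moveLeft h₁ h₂ => left; simp [step, h₂]
  | moveRight h₁ h₂ => left; simp [step, h₂]
  | _ => exact .inr rfl

theorem Stage.Valid.next {w : List Γ} {S S' : Stage Q Γ} (hS : S.Valid M w) (h : S.Next M S') :
    S'.Valid M w := by
  have hr : M.Reaches w S'.config := by
    rcases h.step_or_eq with h' | h'
    · exact hS.reaches.tail h'
    · rw [h']; exact hS.reaches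
  obtain ⟨h2, hh, hb, -, hp⟩ := hS
  cases h with
  | pass h₁ => exact ⟨h2, hh, hb, hr, h₁⟩
  | moveLeft h₁ =>
    refine ⟨h2, Nat.lt_of_succ_lt h₁, fun j hj => ?_, hr, h₁⟩
    rw [← hb j hj]
    refine Function.update_of_ne ?_ _ _
    simp only at hj; omega
  | moveRight h₁ =>
    refine ⟨h2, h₁, fun j hj => ?_, hr, h₁⟩
    rw [← hb j hj]
    refine Function.update_of_ne ?_ _ _
    simp only at hj; omega
  | reachDelim => exact ⟨h2, hh, hb, hr, trivial⟩
  | reachDelimBlank => exact ⟨h2, hh, hb, hr, trivial⟩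
  | extend =>
    exact ⟨Nat.le_succ_of_le h2, Nat.lt_succ_of_lt hh, fun j hj => hb j (Nat.le_of_succ_le hj), hr,
      trivial⟩
  | turn => exact ⟨h2, hh, hb, hr, by simp⟩
  | rise h₁ => exact ⟨h2, hh, hb, hr, h₁, Nat.le_of_succ_le hp.2⟩
  | restart => exact ⟨h2, hh, hb, hr, Nat.zero_le _⟩

/-! ### The block transformation from a stage to the next one -/

/-- A state that takes part in a block transformation with its lower neighbor only if this is the
pulse `◀`. -/
def Passive (M : TuringMachine Q Γ) (z : SimState Q Γ) : Prop :=
  ∀ z', z' ≠ up → M.block z z' = none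

theorem passive_tapeState (c : TMConfig Q Γ) (j : ℕ) : Passive M (tapeState c j) := by
  unfold tapeState
  split_ifs <;> exact fun z hz => by cases z <;> simp_all [block]

theorem passive_frame (n : ℕ) (c : TMConfig Q Γ) (i : ℕ) : Passive M (frame n c i) := by
  unfold frame
  split_ifs
  · exact fun z hz => by cases z <;> simp_all [block]
  · exact passive_tapeState c _
  · exact fun z hz => by cases z <;> simp_all [block]
  · exact fun z hz => by cases z <;> simp_all [block]

theorem frame_ne_up (n : ℕ) (c : TMConfig Q Γ) (i : ℕ) : frame n c i ≠ up := by
  unfold frame tapeState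
  split_ifs <;> simp

@[simp] theorem block_up_left (z : SimState Q Γ) : M.block up z = none := by
  cases z <;> rfl

theorem phaseStates_down_of_ne {n : ℕ} {c : TMConfig Q Γ} {l i : ℕ} (h : i ≠ l) :
    phaseStates n c (.down l) i = frame n c i := if_neg h

theorem phaseStates_down_self {n : ℕ} {c : TMConfig Q Γ} {l : ℕ} :
    phaseStates n c (.down l) l = addArrow (frame n c l) := if_pos rfl

theorem frame_tape {n : ℕ} {c : TMConfig Q Γ} {i : ℕ} (h : i < n) :
    frame n c (i + 1) = tapeState c i := by
  unfold frame
  rw [if_neg (by omega), if_pos (by omega)]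
  rfl

theorem frame_delim {n : ℕ} {c : TMConfig Q Γ} : frame n c (n + 1) = rightDelim := by
  unfold frame
  rw [if_neg (by omega), if_neg (by omega), if_pos rfl]

theorem frame_of_gt {n : ℕ} {c : TMConfig Q Γ} {i : ℕ} (h : n + 1 < i) : frame n c i = quiet := by
  unfold frame
  rw [if_neg (by omega), if_neg (by omega), if_neg (by omega)]

theorem tapeState_head {c : TMConfig Q Γ} {j : ℕ} (h : j = c.head) :
    tapeState c j = head c.state (c.tape c.head) := by
  subst h; exact if_pos rfl

theorem tapeState_of_ne {c : TMConfig Q Γ} {j : ℕ} (h : j ≠ c.head) :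
    tapeState c j = sym (c.tape j) := if_neg h

theorem addArrow_ne_up {z : SimState Q Γ} (h : z ≠ up) : addArrow z ≠ up := by
  cases z <;> simp_all [addArrow]

theorem block_none_of_passive {r : ℕ → SimState Q Γ} {l : ℕ} (h : ∀ i, i ≠ l → Passive M (r i))
    (h' : ∀ i, r i ≠ up) (i : ℕ) (hi : i ≠ l) : M.block (r i) (r (i + 1)) = none :=
  h i hi _ (h' _)

theorem block_none_of_passive_up {r : ℕ → SimState Q Γ} {l : ℕ}
    (h : ∀ i, i ≠ l + 1 → Passive M (r i)) (h' : ∀ i, i ≠ l + 1 → r i ≠ up) (hl : r (l + 1) = up)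
    (i : ℕ) (hi : i ≠ l) : M.block (r i) (r (i + 1)) = none := by
  by_cases hi' : i = l + 1
  · rw [hi', hl, block_up_left]
  · exact h i hi' _ (h' (i + 1) (by omega))

/-- Among the stages at which the pulse moves downwards, a block transformation is applicable at most
to the cell of the pulse and its lower neighbor. -/
theorem block_phaseStates_down {n : ℕ} {c : TMConfig Q Γ} {l : ℕ} (i : ℕ) (hi : i ≠ l) :
    M.block (phaseStates n c (.down l) i) (phaseStates n c (.down l) (i + 1)) = none := by
  refine block_none_of_passive (fun i hi => ?_) (fun i => ?_) i hi
  · rw [phaseStates_down_of_ne hi]; exact passive_frame n c i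
  · by_cases h : i = l
    · rw [h, phaseStates_down_self]; exact addArrow_ne_up (frame_ne_up n c l)
    · rw [phaseStates_down_of_ne h]; exact frame_ne_up n c i

theorem block_phaseStates_delim {n : ℕ} {c : TMConfig Q Γ} {ph : Phase}
    (hph : ph = .delimBlank ∨ ph = .delimUp) (i : ℕ) (hi : i ≠ n + 1) :
    M.block (phaseStates n c ph i) (phaseStates n c ph (i + 1)) = none := by
  refine block_none_of_passive (fun i hi => ?_) (fun i => ?_) i hi
  · rcases hph with rfl | rfl <;> simpa only [phaseStates, if_neg hi] using passive_frame n c i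
  · rcases hph with rfl | rfl <;> simp only [phaseStates] <;> split_ifs <;>
      first | exact frame_ne_up n c i | simp

theorem block_phaseStates_up {n : ℕ} {c : TMConfig Q Γ} {l : ℕ} (i : ℕ) (hi : i ≠ l) :
    M.block (phaseStates n c (.up (l + 1)) i) (phaseStates n c (.up (l + 1)) (i + 1)) = none := by
  refine block_none_of_passive_up (fun i hi => ?_) (fun i hi => ?_) ?_ i hi
  · simp only [phaseStates, if_neg hi]
    split_ifs <;> exact passive_frame _ _ _
  · simp only [phaseStates, if_neg hi]
    split_ifs <;> exact frame_ne_up _ _ _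
  · simp [phaseStates]

theorem placeAt_of_nat {m : ℕ} {r : ℕ → SimState Q Γ} {i : ℕ} {k : ℤ} (h : k = m + i) :
    placeAt m r k = r i := by
  subst h
  unfold placeAt
  rw [if_neg (by omega)]
  congr 1
  omega

theorem placeAt_of_lt {m : ℕ} {r : ℕ → SimState Q Γ} {k : ℤ} (h : k < m) :
    placeAt m r k = quiet := if_pos h

theorem placeAt_succ {m : ℕ} {r : ℕ → SimState Q Γ} :
    placeAt (m + 1) r = placeAt m fun i => if i = 0 then quiet else r (i - 1) := by
  funext k
  rcases lt_trichotomy k m with h | rfl | h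
  · rw [placeAt_of_lt h, placeAt_of_lt (by push_cast; omega)]
  · rw [placeAt_of_lt (by push_cast; omega), placeAt_of_nat (i := 0) (by simp), if_pos rfl]
  · obtain ⟨i, rfl⟩ : ∃ i : ℕ, k = m + (i + 1 : ℕ) := ⟨(k - m - 1).toNat, by omega⟩
    rw [placeAt_of_nat rfl, placeAt_of_nat (i := i) (by push_cast; ring), if_neg (by omega)]
    rfl

theorem block_placeAt_none {m : ℕ} {r : ℕ → SimState Q Γ} {k : ℤ}
    (h : ∀ i : ℕ, k = m + i → M.block (r i) (r (i + 1)) = none) :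
    M.block (placeAt m r k) (placeAt m r (k + 1)) = none := by
  rcases lt_or_ge k m with hk | hk
  · rw [placeAt_of_lt hk, block_quiet_left]
  · obtain ⟨i, rfl⟩ : ∃ i : ℕ, k = m + i := ⟨(k - m).toNat, by omega⟩
    rw [placeAt_of_nat rfl, placeAt_of_nat (i := i + 1) (by push_cast; ring)]
    exact h i rfl

theorem isEvent_placeAt {m l : ℕ} {r r' : ℕ → SimState Q Γ} {t t' : ℝ} (h₁ : t < t')
    (h₂ : t' ≤ t + cycle (m + l : ℕ)) (h₃ : IsTick (m + l : ℕ) t')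
    (h₄ : M.block (r l) (r (l + 1)) = some (r' l, r' (l + 1)))
    (h₅ : ∀ i, i ≠ l → M.block (r i) (r (i + 1)) = none)
    (h₆ : ∀ i, i ≠ l → i ≠ l + 1 → r' i = r i) :
    IsEvent M (m + l : ℕ) (placeAt m r) (placeAt m r') t t' := by
  refine ⟨h₁, h₂, h₃, ?_, fun k hk => block_placeAt_none fun i hi => h₅ i ?_, fun k hk hk' => ?_⟩
  · have e₀ : ((m + l : ℕ) : ℤ) = m + l := by push_cast; rfl
    have e₁ : ((m + l : ℕ) : ℤ) + 1 = m + (l + 1 : ℕ) := by push_cast; ring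
    rw [placeAt_of_nat e₁, placeAt_of_nat e₁, placeAt_of_nat e₀, placeAt_of_nat e₀, h₄]
  · rintro rfl; push_cast at hk; omega
  · rcases lt_or_ge k m with h | h
    · rw [placeAt_of_lt h, placeAt_of_lt h]
    · obtain ⟨i, rfl⟩ : ∃ i : ℕ, k = m + i := ⟨(k - m).toNat, by omega⟩
      rw [placeAt_of_nat rfl, placeAt_of_nat rfl]
      push_cast at hk hk'
      exact h₆ i (by omega) (by omega)

/-! ### The times of the stages -/

theorem IsTick.add {k : ℤ} {t u : ℝ} (ht : IsTick k t) (hu : IsTick k u) : IsTick k (t + u) := by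
  obtain ⟨a, rfl⟩ := ht
  obtain ⟨b, rfl⟩ := hu
  exact ⟨a + b, by push_cast; ring⟩

theorem IsTick.int_mul {k : ℤ} {t : ℝ} (ht : IsTick k t) (N : ℤ) : IsTick k (N * t) := by
  obtain ⟨a, rfl⟩ := ht
  exact ⟨N * a, by push_cast; ring⟩

theorem isTick_cycle {m k : ℕ} (h : m ≤ k) : IsTick k (cycle m) := by
  induction k, h using Nat.le_induction with
  | base => exact ⟨1, by simp⟩
  | succ k _ ih => push_cast; exact ih.succ

theorem cycle_zero : cycle 0 = 1 := by simp [cycle]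

theorem cycle_nat (k : ℕ) : cycle k = 2 * cycle (k + 1 : ℕ) := by
  rw [cycle_eq_two_mul]; push_cast; rfl

theorem cycle_anti {m k : ℕ} (h : m ≤ k) : cycle k ≤ cycle m := by
  induction k, h using Nat.le_induction with
  | base => exact le_rfl
  | succ k _ ih => have := cycle_nat k; have := cycle_pos (k + 1 : ℕ); linarith

/-- The times of the stages are of this form. -/
theorem isTick_combination {m k l : ℕ} (hm : m ≤ l) (hk : k ≤ l) (N : ℤ) :
    IsTick l (6 - 4 * cycle m + N * cycle k) := by
  have h₁ : IsTick l 6 := by simpa [cycle_zero] using (isTick_cycle (Nat.zero_le l)).int_mul 6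
  have h₂ := (isTick_cycle hm).int_mul (-4)
  have h₃ := (isTick_cycle hk).int_mul N
  have := (h₁.add h₂).add h₃
  push_cast at this
  convert this using 1
  ring

theorem Stage.Valid.time_lt {w : List Γ} {S : Stage Q Γ} (hS : S.Valid M w) :
    S.time < 6 - 3 * cycle S.offset := by
  obtain ⟨m, n, c, ph⟩ := S
  have hp := hS.phase
  have hm := cycle_pos m
  rcases ph with i | _ | _ | i
  · have := cycle_pos (m + i : ℕ)
    simp only [Stage.time]; linarith
  · have := cycle_pos (m + n : ℕ)
    simp only [Stage.time]; linarith
  · have := cycle_pos (m + n : ℕ)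
    simp only [Stage.time]; linarith
  · have h₁ := cycle_pos (m + i : ℕ)
    have h₂ := cycle_anti (m := m + 1) (k := m + i) (by have := hp.1; omega)
    have h₃ := cycle_nat m
    simp only [Stage.time]
    split_ifs <;> linarith

theorem Stage.time_ge {S : Stage Q Γ} : 6 - 6 * cycle S.offset ≤ S.time := by
  obtain ⟨m, n, c, ph⟩ := S
  have hm := cycle_pos m
  rcases ph with i | _ | _ | i
  · have := cycle_anti (m := m) (k := m + i) (by omega)
    simp only [Stage.time]; linarith
  · have := cycle_anti (m := m) (k := m + n) (by omega)
    simp only [Stage.time]; linarith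
  · have := cycle_anti (m := m) (k := m + n) (by omega)
    simp only [Stage.time]; linarith
  · have h₁ := cycle_pos (m + i : ℕ)
    have := cycle_anti (m := m) (k := m + i) (by omega)
    simp only [Stage.time]
    split_ifs <;> linarith

theorem Stage.Next.time_le {w : List Γ} {S S' : Stage Q Γ} (hS : S.Valid M w) (h : S.Next M S') :
    S'.time ≤ 6 - 3 * cycle S.offset := by
  have h' := (hS.next h).time_lt
  cases h with
  | @restart m n c =>
    have := cycle_nat m
    simp only [Stage.time, add_zero]; linarith
  | _ => exact h'.le

/-! ### The block transformations from a stage to the next one -/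

theorem isEvent_down {m n l : ℕ} {c c' : TMConfig Q Γ}
    (hb : M.block (addArrow (frame n c l)) (frame n c (l + 1)) =
      some (frame n c' l, addArrow (frame n c' (l + 1))))
    (hf : ∀ i, i ≠ l → i ≠ l + 1 → frame n c' i = frame n c i) :
    ∃ p, IsEvent M p (Stage.cells ⟨m, n, c, .down l⟩) (Stage.cells ⟨m, n, c', .down (l + 1)⟩)
      (Stage.time ⟨m, n, c, .down l⟩) (Stage.time ⟨m, n, c', .down (l + 1)⟩) := by
  have hc := cycle_nat (m + l)
  have hc' := cycle_pos (m + l + 1 : ℕ)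
  refine ⟨_, isEvent_placeAt (l := l) ?_ ?_ ?_ ?_ ?_ ?_⟩
  · simp only [Stage.time, ← add_assoc]; linarith
  · simp only [Stage.time, ← add_assoc]; linarith
  · have := isTick_combination (Nat.le_add_right m l) le_rfl (-1)
    simp only [Stage.time, ← add_assoc, ← hc]
    simpa using this
  · rw [phaseStates_down_self, phaseStates_down_of_ne (by omega),
      phaseStates_down_of_ne (by omega), phaseStates_down_self]
    exact hb
  · exact block_phaseStates_down
  · intro i h₁ h₂
    rw [phaseStates_down_of_ne h₁, phaseStates_down_of_ne h₂, hf i h₁ h₂]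

theorem isEvent_delim {m n : ℕ} {c : TMConfig Q Γ} {ph : Phase}
    (hph : ph = .delimBlank ∨ ph = .delimUp)
    (hb : M.block (addArrow (frame n c n)) rightDelim =
      some (frame n c n, phaseStates n c ph (n + 1))) :
    ∃ p, IsEvent M p (Stage.cells ⟨m, n, c, .down n⟩) (Stage.cells ⟨m, n, c, ph⟩)
      (Stage.time ⟨m, n, c, .down n⟩) (Stage.time ⟨m, n, c, ph⟩) := by
  have hc' := cycle_pos (m + n : ℕ)
  have ht : Stage.time ⟨m, n, c, ph⟩ = 6 - 4 * cycle m - cycle (m + n : ℕ) := by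
    rcases hph with rfl | rfl <;> simp only [Stage.time] <;> ring
  have hne : ∀ i, i ≠ n + 1 → phaseStates n c ph i = frame n c i := by
    intro i hi
    rcases hph with rfl | rfl <;> simp only [phaseStates, if_neg hi]
  refine ⟨_, isEvent_placeAt (l := n) ?_ ?_ ?_ ?_ ?_ ?_⟩
  · rw [ht]; simp only [Stage.time]; linarith
  · rw [ht]; simp only [Stage.time]; linarith
  · have := isTick_combination (Nat.le_add_right m n) le_rfl (-1)
    rw [ht]
    simpa [sub_eq_add_neg] using this
  · rw [phaseStates_down_self, phaseStates_down_of_ne (by omega), frame_delim, hb,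
      hne n (by omega)]
  · exact block_phaseStates_down
  · intro i h₁ h₂
    rw [phaseStates_down_of_ne h₁, hne i h₂]

theorem dir_eq_some {c : TMConfig Q Γ} {d : Turing.Dir} (h : M.dir c = some d) :
    ∃ p b, M.delta c.state (c.tape c.head) = some (p, b, d) := by
  rw [dir, Option.map_eq_some_iff] at h
  obtain ⟨⟨p, b, d'⟩, h, rfl⟩ := h
  exact ⟨p, b, h⟩

theorem tapeState_cases (c : TMConfig Q Γ) (j : ℕ) :
    (∃ a, tapeState c j = sym a) ∨ ∃ q a, tapeState c j = head q a := by
  unfold tapeState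
  split_ifs
  · exact .inr ⟨_, _, rfl⟩
  · exact .inl ⟨_, rfl⟩

theorem block_tape_up (c : TMConfig Q Γ) (j : ℕ) :
    M.block (tapeState c j) up = some (up, tapeState c j) := by
  rcases tapeState_cases c j with ⟨a, h⟩ | ⟨q, a, h⟩ <;> rw [h] <;> rfl

theorem tapeState_update_of_ne {p q : Q} {h h' k j : ℕ} {T : ℕ → Γ} {b : Γ} (h₁ : j ≠ h)
    (h₂ : j ≠ h') (h₃ : j ≠ k) :
    tapeState ⟨p, h', Function.update T k b⟩ j = tapeState ⟨q, h, T⟩ j := by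
  simp only [tapeState, if_neg h₁, if_neg h₂, Function.update_of_ne h₃]

theorem frame_congr {n : ℕ} {c c' : TMConfig Q Γ} {i : ℕ}
    (h : i ≠ 0 → tapeState c' (i - 1) = tapeState c (i - 1)) : frame n c' i = frame n c i := by
  unfold frame
  by_cases hi : i = 0
  · simp [hi]
  · rw [h hi]

/-- Each stage is followed by the next one through the only applicable block transformation. -/
theorem Stage.Next.isEvent {w : List Γ} {S S' : Stage Q Γ} (hS : S.Valid M w) (h : S.Next M S') :
    ∃ p, IsEvent M p S.cells S'.cells S.time S'.time := by
  have h2 := hS.two_le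
  have hh := hS.head_lt
  have hbl := hS.blank
  have hp := hS.phase
  cases h with
  | @pass m n c i hi hR hL =>
    refine isEvent_down ?_ fun _ _ _ => rfl
    rw [frame_tape hi]
    rcases i with _ | i
    · rcases tapeState_cases c 0 with ⟨a, h⟩ | ⟨q, a, h⟩ <;> rw [h] <;> rfl
    · rw [frame_tape (by omega)]
      by_cases h₁ : i + 1 = c.head
      · obtain ⟨p, b, hδ⟩ := dir_eq_some (hR h₁ (by omega))
        rw [tapeState_head h₁, tapeState_of_ne (by omega)]
        simp [addArrow, block, hδ]
      · rw [tapeState_of_ne h₁]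
        by_cases h₂ : i = c.head
        · obtain ⟨p, b, hδ⟩ := dir_eq_some (hL (by omega))
          rw [tapeState_head h₂]
          simp [addArrow, block, hδ]
        · rw [tapeState_of_ne h₂]
          simp [addArrow, block]
  | @moveLeft m n q h T p b hn hδ =>
    refine isEvent_down ?_ fun i h₁ h₂ => frame_congr fun h₀ =>
      tapeState_update_of_ne (by omega) (by omega) (by omega)
    rw [frame_tape (by omega), frame_tape (by omega), frame_tape (by omega),
      frame_tape (by omega), tapeState_of_ne (by simp), tapeState_head rfl, tapeState_head rfl,
      tapeState_of_ne (by simp)]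
    simp [addArrow, block, hδ]
  | @moveRight m n q h T p b hn hδ =>
    refine isEvent_down ?_ fun i h₁ h₂ => frame_congr fun h₀ =>
      tapeState_update_of_ne (by omega) (by omega) (by omega)
    rw [frame_tape (by omega), frame_tape (by omega), frame_tape (by omega),
      frame_tape (by omega), tapeState_head rfl, tapeState_of_ne (by simp), tapeState_of_ne (by simp),
      tapeState_head rfl]
    simp [addArrow, block, hδ]
  | @reachDelim m n c hL =>
    refine isEvent_delim (.inr rfl) ?_
    obtain ⟨n, rfl⟩ : ∃ k, n = k + 1 := ⟨n - 1, by simp only at h2; omega⟩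
    rw [frame_tape (by omega)]
    by_cases h : n = c.head
    · obtain ⟨p, b, hδ⟩ := dir_eq_some (hL (by omega))
      rw [tapeState_head h]
      simp [addArrow, block, hδ, phaseStates]
    · rw [tapeState_of_ne h]
      simp [addArrow, block, phaseStates]
  | @reachDelimBlank m n c hn hR =>
    refine isEvent_delim (.inl rfl) ?_
    subst hn
    obtain ⟨p, b, hδ⟩ := dir_eq_some hR
    rw [frame_tape (by omega), tapeState_head rfl]
    simp [addArrow, block, hδ, phaseStates]
  | @extend m n c =>
    have hc := cycle_nat (m + n)
    have hc' := cycle_pos (m + n + 1 : ℕ)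
    refine ⟨_, isEvent_placeAt (l := n + 1) ?_ ?_ ?_ ?_ ?_ ?_⟩
    · simp only [Stage.time, ← add_assoc]; linarith
    · simp only [Stage.time, ← add_assoc]; linarith
    · simpa [Stage.time] using isTick_combination (Nat.le_add_right m (n + 1)) le_rfl (-1)
    · simp only at hh hbl
      simp only [phaseStates, if_true]
      rw [if_neg (by omega), if_neg (by omega), frame_of_gt (by omega), frame_tape (by omega),
        tapeState_of_ne (by omega), hbl n le_rfl]
      simp [block]
    · exact block_phaseStates_delim (.inl rfl)
    · intro i h₁ h₂
      simp only [phaseStates, if_neg h₁, if_neg h₂]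
      unfold frame
      split_ifs <;> first | rfl | omega
  | @turn m n c =>
    have hc := cycle_nat (m + n)
    have hc' := cycle_pos (m + n + 1 : ℕ)
    refine ⟨_, isEvent_placeAt (l := n + 1) ?_ ?_ ?_ ?_ ?_ ?_⟩
    · simp only [Stage.time, ← add_assoc, if_true]; linarith
    · simp only [Stage.time, ← add_assoc, if_true]; linarith
    · simpa [Stage.time] using isTick_combination (Nat.le_add_right m (n + 1)) le_rfl (-1)
    · simp only [phaseStates, if_true, lt_irrefl, if_false]
      rw [if_neg (by omega), if_neg (by omega), if_neg (by omega), frame_of_gt (by omega),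
        Nat.add_sub_cancel, frame_delim]
      simp [block]
    · exact block_phaseStates_delim (.inr rfl)
    · intro i h₁ h₂
      simp only [phaseStates, if_neg h₁]
      split_ifs with h
      · rfl
      · rw [frame_of_gt (by omega), frame_of_gt (by omega)]
  | @rise m n c i hi =>
    obtain ⟨hi₁, hi₂⟩ : 1 ≤ i + 1 ∧ i + 1 ≤ n + 1 := hp
    have hc := cycle_nat (m + i)
    have hc' := cycle_pos (m + i + 1 : ℕ)
    refine ⟨_, isEvent_placeAt (l := i) ?_ ?_ ?_ ?_ block_phaseStates_up ?_⟩
    · simp only [Stage.time, ← add_assoc]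
      split_ifs <;> first | linarith | omega
    · simp only [Stage.time, ← add_assoc]
      split_ifs <;> first | linarith | omega
    · have h := isTick_combination (Nat.le_add_right m i) le_rfl
      simp only [Stage.time, if_neg (show i ≠ n + 1 by omega)]
      split_ifs
      · simpa using h 0
      · simpa using h 1
    · obtain ⟨i, rfl⟩ : ∃ k, i = k + 1 := ⟨i - 1, by omega⟩
      simp only [phaseStates, if_true, lt_irrefl, if_false]
      rw [if_pos (by omega), if_neg (by omega), if_neg (by omega), Nat.add_sub_cancel,
        frame_tape (by omega), block_tape_up]
    · intro k h₁ h₂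
      simp only [phaseStates, if_neg h₁, if_neg h₂]
      split_ifs <;> first | rfl | omega
  | @restart m n c =>
    have hc := cycle_nat m
    have hc' := cycle_pos (m + 1 : ℕ)
    rw [Stage.cells, Stage.cells, placeAt_succ]
    simp only at h2
    refine ⟨_, isEvent_placeAt (l := 0) ?_ ?_ ?_ ?_ block_phaseStates_up ?_⟩
    · simp only [Stage.time, add_zero]
      rw [if_neg (by omega), if_neg (by omega)]
      linarith
    · simp only [Stage.time, add_zero]
      rw [if_neg (by omega), if_neg (by omega)]
      linarith
    · have h := isTick_combination (Nat.le_add_right m 0) (Nat.le_add_right m 0) 1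
      convert h using 1
      simp only [Stage.time, add_zero]
      push_cast at hc ⊢
      linarith
    · simp [phaseStates, frame, block, addArrow]
    · intro k h₁ h₂
      simp only [phaseStates, if_neg h₁]
      rw [if_neg (by omega), if_neg (by omega), if_neg (by omega)]

/-! ### Progress of the simulation -/

theorem Stage.Stuck.delta_eq {S : Stage Q Γ} (h : S.Stuck M) :
    M.delta S.config.state (S.config.tape S.config.head) = none := by
  cases h with
  | intro _ _ hδ => exact hδ

theorem Stage.Stuck.step_eq {S : Stage Q Γ} (h : S.Stuck M) : M.step S.config = none := by
  rw [step, h.delta_eq]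

theorem Stage.Stuck.not_next {w : List Γ} {S S' : Stage Q Γ} (hS : S.Valid M w) (h : S.Stuck M) :
    ¬ S.Next M S' := by
  intro h'
  have hh := hS.head_lt
  have hδ := h.delta_eq
  have hd : M.dir S.config = none := by rw [dir, hδ]; rfl
  cases h with
  | intro h₀ hi _ =>
    cases h' with
    | pass _ hR hL =>
      rcases hi with hi | hi
      · have := hR hi h₀; simp_all
      · have := hL hi; simp_all
    | moveLeft _ h => simp_all
    | moveRight _ h => simp_all
    | reachDelim hL =>
      rcases hi with hi | hi
      · exact hh.ne' hi
      · have := hL hi; simp_all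
    | reachDelimBlank _ h => simp_all

theorem Stage.Stuck.block_eq_none {w : List Γ} {S : Stage Q Γ} (hS : S.Valid M w)
    (h : S.Stuck M) (k : ℤ) : M.block (S.cells k) (S.cells (k + 1)) = none := by
  refine block_placeAt_none fun i _ => ?_
  have hh := hS.head_lt
  have hp := hS.phase
  cases h with
  | @intro m n c l h₀ hl hδ =>
    change M.block (phaseStates n c (.down l) i) (phaseStates n c (.down l) (i + 1)) = none
    by_cases hi : i = l
    · subst hi
      simp only at hh hp
      rw [phaseStates_down_self, phaseStates_down_of_ne (by omega)]
      obtain ⟨l, rfl⟩ : ∃ l, i = l + 1 := ⟨i - 1, by omega⟩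
      rw [frame_tape (by omega)]
      rcases hl with hl | hl
      · rw [frame_tape (by omega), tapeState_head hl, tapeState_of_ne (by omega)]
        simp [addArrow, block, hδ]
      · rw [tapeState_head (by omega)]
        rcases hp.lt_or_eq with hn | hn
        · rw [frame_tape hn, tapeState_of_ne (by omega)]
          simp [addArrow, block, hδ]
        · rw [hn, frame_delim]
          simp [addArrow, block, hδ]
    · exact block_phaseStates_down i hi

/-- A bound for the number of stages that remain until the end of the pass. -/
def Stage.remaining (S : Stage Q Γ) : ℕ :=
  match S.phase with
  | .down i => 2 * S.size + 6 - i
  | .delimBlank => S.size + 5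
  | .delimUp => S.size + 3
  | .up i => i

theorem Stage.Next.remaining_lt {S S' : Stage Q Γ} (h : S.Next M S') :
    S'.offset = S.offset + 1 ∨ S'.offset = S.offset ∧ S'.remaining < S.remaining := by
  cases h <;> simp_all [Stage.remaining] <;> omega

open Classical in
/-- A bound for the number of passes that begin before the next move of the Turing machine. If the
head is on the last tape cell and has to move to the right, one pass is needed to append a blank
tape cell. -/
noncomputable def Stage.passes (M : TuringMachine Q Γ) (S : Stage Q Γ) : ℕ :=
  match S.phase with
  | .down i =>
    if M.dir S.config = some .right ∧ S.config.head + 1 = S.size then 2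
    else if i ≤ S.config.head ∨ i = S.config.head + 1 ∧ M.dir S.config ≠ some .left then 0
    else 1
  | .delimBlank => 2
  | _ => if M.dir S.config = some .right ∧ S.config.head + 1 = S.size then 3 else 1

/-- If the Turing machine does not move between a stage and the next one, then the pair of `passes`
and `remaining` decreases lexicographically: a pass in which the Turing machine does not move, and
which begins with the head not on the last tape cell, would have to cross the head without effect,
which is impossible, as the head does not move to the left from tape cell `0`. -/
theorem Stage.Next.step_or_progress {w : List Γ} {S S' : Stage Q Γ} (hM : M.StaysOnTape w)
    (hS : S.Valid M w) (h : S.Next M S') :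
    M.step S.config = some S'.config ∨ S'.config = S.config ∧
      (S'.passes M < S.passes M ∨ S'.passes M = S.passes M ∧ S'.remaining < S.remaining) := by
  have hh := hS.head_lt
  have hleft : S.config.head = 0 → M.dir S.config ≠ some .left := by
    intro h₀ hd
    obtain ⟨p, b, hδ⟩ := dir_eq_some hd
    exact hM _ hS.reaches h₀ p b hδ
  cases h with
  | moveLeft h₁ h₂ => left; simp [step, h₂]
  | moveRight h₁ h₂ => left; simp [step, h₂]
  | @pass m n c i hi hR hL =>
    simp only at hh hleft
    refine .inr ⟨rfl, ?_⟩
    simp only [Stage.passes, Stage.remaining]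
    by_cases h₁ : M.dir c = some .right ∧ c.head + 1 = n
    · rw [if_pos h₁, if_pos h₁]; omega
    · rw [if_neg h₁, if_neg h₁]
      by_cases h₂ : i ≤ c.head ∨ i = c.head + 1 ∧ M.dir c ≠ some .left
      · have h₃ : i + 1 ≤ c.head ∨ i + 1 = c.head + 1 ∧ M.dir c ≠ some .left := by
          rcases h₂ with h₂ | ⟨h₂, h₃⟩
          · rcases h₂.lt_or_eq with h₂ | h₂
            · exact .inl h₂
            · refine .inr ⟨by omega, ?_⟩
              rcases Nat.eq_zero_or_pos i with h₀ | h₀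
              · exact hleft (by omega)
              · rw [hR h₂ h₀]; simp
          · exact absurd (hL h₂) h₃
        rw [if_pos h₂, if_pos h₃]; omega
      · rw [if_neg h₂]
        split_ifs <;> omega
  | @reachDelim m n c hL =>
    simp only at hh
    refine .inr ⟨rfl, ?_⟩
    simp only [Stage.passes, Stage.remaining]
    have h₁ : ¬ (M.dir c = some .right ∧ c.head + 1 = n) := by
      rintro ⟨h₁, h₂⟩
      rw [hL h₂.symm] at h₁
      simp at h₁
    have h₂ : ¬ (n ≤ c.head ∨ n = c.head + 1 ∧ M.dir c ≠ some .left) := by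
      rintro (h₂ | ⟨h₂, h₃⟩)
      · omega
      · exact h₃ (hL h₂)
    rw [if_neg h₁, if_neg h₁, if_neg h₂]
    omega
  | @reachDelimBlank m n c hn hR =>
    refine .inr ⟨rfl, ?_⟩
    simp only [Stage.passes, Stage.remaining]
    rw [if_pos ⟨hR, hn.symm⟩]
    omega
  | @extend m n c =>
    simp only at hh
    refine .inr ⟨rfl, .inl ?_⟩
    simp only [Stage.passes]
    rw [if_neg (by omega)]
    omega
  | turn => exact .inr ⟨rfl, .inr ⟨rfl, by simp [Stage.remaining]⟩⟩
  | rise => exact .inr ⟨rfl, .inr ⟨rfl, by simp [Stage.remaining]⟩⟩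
  | @restart m n c =>
    refine .inr ⟨rfl, .inl ?_⟩
    simp only [Stage.passes]
    split_ifs <;> omega

/-! ### The sequence of stages -/

open Classical in
/-- The next stage; the same stage if there is none. -/
noncomputable def Stage.succ (M : TuringMachine Q Γ) (S : Stage Q Γ) : Stage Q Γ :=
  if h : ∃ S', S.Next M S' then h.choose else S

theorem Stage.next_succ {S : Stage Q Γ} (h : ∃ S', S.Next M S') : S.Next M (S.succ M) := by
  rw [Stage.succ, dif_pos h]; exact h.choose_spec

theorem Stage.Stuck.succ_eq {w : List Γ} {S : Stage Q Γ} (hS : S.Valid M w) (h : S.Stuck M) :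
    S.succ M = S :=
  dif_neg fun ⟨_, h'⟩ => h.not_next hS h'

theorem Stage.Valid.succ {w : List Γ} {S : Stage Q Γ} (hS : S.Valid M w) :
    (S.succ M).Valid M w := by
  rcases hS.stuck_or_next with h | h
  · rwa [h.succ_eq hS]
  · exact hS.next (Stage.next_succ h)

theorem Stage.Valid.next_of_not_stuck {w : List Γ} {S : Stage Q Γ} (hS : S.Valid M w)
    (h : ¬ S.Stuck M) : S.Next M (S.succ M) :=
  Stage.next_succ (hS.stuck_or_next.resolve_left h)

/-- The initial stage. -/
def initStage (M : TuringMachine Q Γ) (w : List Γ) : Stage Q Γ :=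
  ⟨0, max 2 w.length, M.initConfig w, .down 0⟩

theorem initStage_valid (w : List Γ) : (M.initStage w).Valid M w := by
  refine ⟨le_max_left _ _, ?_, fun j hj => ?_, .refl, Nat.zero_le _⟩
  · exact lt_of_lt_of_le (by simp [initStage, initConfig]) (le_max_left 2 w.length)
  · exact List.getD_eq_default _ _ (le_trans (le_max_right _ _) hj)

theorem initStage_time (w : List Γ) : (M.initStage w).time = 0 := by
  simp [initStage, Stage.time, cycle_zero]
  norm_num

theorem initStage_cells (w : List Γ) : (M.initStage w).cells = M.simInit w := by
  funext k
  rcases k with k | k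
  · rw [Stage.cells, placeAt_of_nat (i := k) (by simp [initStage])]
    change phaseStates (max 2 w.length) (M.initConfig w) (.down 0) k =
      (M.simInitWord w).getD k quiet
    rcases w with _ | ⟨a, _ | ⟨b, w⟩⟩
    · rcases k with _ | _ | _ | _ | k <;> simp [phaseStates, frame, addArrow, simInitWord,
        tapeState, initConfig]
    · rcases k with _ | _ | _ | _ | k <;> simp [phaseStates, frame, addArrow, simInitWord,
        tapeState, initConfig]
    · have hmax : max 2 (a :: b :: w).length = w.length + 2 := by simp
      rw [hmax]
      rcases k with _ | _ | k
      · simp [phaseStates, frame, addArrow, simInitWord]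
      · simp [phaseStates, frame, simInitWord, tapeState, initConfig]
      · rw [phaseStates_down_of_ne (by omega)]
        change _ = ((b :: w).map sym ++ [rightDelim]).getD k quiet
        rcases lt_trichotomy k (w.length + 1) with h | rfl | h
        · rw [frame_tape (by omega), tapeState_of_ne (by simp [initConfig]),
            List.getD_append _ _ _ _ (by simpa using h),
            List.getD_eq_getElem _ _ (by simpa using h), List.getElem_map]
          congr 1
          exact List.getD_eq_getElem _ _ (by simpa using h)
        · rw [frame_delim, List.getD_append_right _ _ _ _ (by simp)]
          simp
        · rw [frame_of_gt (by omega), List.getD_eq_default _ _ (by simp; omega)]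
  · exact placeAt_of_lt (by simp [initStage])

/-- The sequence of stages on the input word `w`. -/
noncomputable def stageSeq (M : TuringMachine Q Γ) (w : List Γ) : ℕ → Stage Q Γ
  | 0 => M.initStage w
  | i + 1 => (stageSeq M w i).succ M

open Classical in
/-- The times of the stages in the sequence. After the pulse has got stuck, time advances in steps
of one cycle of cell `0`, so that the times are unbounded. -/
noncomputable def timeSeq (M : TuringMachine Q Γ) (w : List Γ) : ℕ → ℝ
  | 0 => 0
  | i + 1 => if (M.stageSeq w i).Stuck M then timeSeq M w i + 1 else (M.stageSeq w (i + 1)).time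

theorem stageSeq_valid (w : List Γ) (i : ℕ) : (M.stageSeq w i).Valid M w := by
  induction i with
  | zero => exact initStage_valid w
  | succ i ih => exact ih.succ

theorem timeSeq_eq {w : List Γ} {i : ℕ} (h : ∀ j < i, ¬ (M.stageSeq w j).Stuck M) :
    M.timeSeq w i = (M.stageSeq w i).time := by
  rcases i with _ | i
  · exact (initStage_time w).symm
  · exact if_neg (h i i.lt_succ_self)

theorem stageSeq_add_of_stuck {w : List Γ} {i : ℕ} (h : (M.stageSeq w i).Stuck M) (d : ℕ) :
    M.stageSeq w (i + d) = M.stageSeq w i := by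
  induction d with
  | zero => rfl
  | succ d ih => rw [← add_assoc, stageSeq, ih, h.succ_eq (M.stageSeq_valid w i)]

theorem timeSeq_add_of_stuck {w : List Γ} {i : ℕ} (h : (M.stageSeq w i).Stuck M) (d : ℕ) :
    M.timeSeq w (i + d) = M.timeSeq w i + d := by
  induction d with
  | zero => simp
  | succ d ih =>
    rw [← add_assoc, timeSeq, stageSeq_add_of_stuck h, if_pos h, ih]
    push_cast; ring

theorem isEventSequence_stageSeq (w : List Γ) :
    IsEventSequence M (fun i => (M.stageSeq w i).cells) (M.timeSeq w) := by
  have key : ∀ i, ¬ (M.stageSeq w i).Stuck M → ∃ p, IsEvent M p (M.stageSeq w i).cells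
      (M.stageSeq w (i + 1)).cells (M.timeSeq w i) (M.timeSeq w (i + 1)) := by
    intro i hi
    have hj : ∀ j < i + 1, ¬ (M.stageSeq w j).Stuck M := by
      intro j hj hs
      obtain ⟨d, rfl⟩ := Nat.exists_eq_add_of_le (Nat.le_of_lt_succ hj)
      rw [stageSeq_add_of_stuck hs] at hi
      exact hi hs
    rw [timeSeq_eq hj, timeSeq_eq fun j hj' => hj j (by omega)]
    have hv := M.stageSeq_valid w i
    exact (hv.next_of_not_stuck hi).isEvent hv
  refine ⟨rfl, fun i => ?_, fun i => ?_⟩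
  · by_cases hi : (M.stageSeq w i).Stuck M
    · rw [timeSeq_add_of_stuck hi 1]; simp
    · obtain ⟨p, hp⟩ := key i hi
      exact hp.lt
  · by_cases hi : (M.stageSeq w i).Stuck M
    · refine .inr ⟨hi.block_eq_none (M.stageSeq_valid w i), ?_⟩
      rw [stageSeq_add_of_stuck hi 1]
    · exact .inl (key i hi)

theorem Stage.cells_of_lt {S : Stage Q Γ} {k : ℤ} (h : k < S.offset) : S.cells k = quiet :=
  placeAt_of_lt h

theorem Stage.Valid.cells_offset_ne {w : List Γ} {S : Stage Q Γ} (hS : S.Valid M w) :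
    S.cells S.offset ≠ quiet := by
  have hp := hS.phase
  rw [Stage.cells, placeAt_of_nat (i := 0) (by simp)]
  obtain ⟨m, n, c, ph⟩ := S
  rcases ph with i | _ | _ | i
  · simp only [phaseStates, frame]
    split_ifs <;> simp_all [addArrow]
  · simp [phaseStates, frame]
  · simp [phaseStates, frame]
  · simp only [phaseStates]
    rw [if_pos (show 0 < i from hp.1)]
    simp [frame]

theorem Stage.exists_quiet (S : Stage Q Γ) : ∃ K : ℤ, ∀ k, K ≤ k → S.cells k = quiet := by
  obtain ⟨m, n, c, ph⟩ := S
  have hp : ∃ L, ∀ l, ph = .up l → l ≤ L := by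
    rcases ph with i | _ | _ | i
    · exact ⟨0, fun l h => by cases h⟩
    · exact ⟨0, fun l h => by cases h⟩
    · exact ⟨0, fun l h => by cases h⟩
    · exact ⟨i, fun l h => by cases h; exact le_rfl⟩
  obtain ⟨L, hL⟩ := hp
  refine ⟨m + n + 3 + L, fun k hk => ?_⟩
  obtain ⟨i, rfl⟩ : ∃ i : ℕ, k = m + i := ⟨(k - m).toNat, by omega⟩
  rw [Stage.cells, placeAt_of_nat rfl]
  have h₁ : frame n c i = quiet := frame_of_gt (by omega)
  have h₂ : frame n c (i - 1) = quiet := frame_of_gt (by omega)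
  rcases ph with l | _ | _ | l
  · simp only [phaseStates, h₁]; split_ifs <;> rfl
  · simp only [phaseStates, h₁]; rw [if_neg (by omega)]
  · simp only [phaseStates, h₁]; rw [if_neg (by omega)]
  · have := hL l rfl
    simp only [phaseStates, h₂]; rw [if_neg (by omega), if_neg (by omega)]

theorem timeSeq_lt_six {w : List Γ} {i : ℕ} (h : ∀ j < i, ¬ (M.stageSeq w j).Stuck M) :
    M.timeSeq w i < 6 := by
  rw [timeSeq_eq h]
  have := (M.stageSeq_valid w i).time_lt
  have := cycle_pos (M.stageSeq w i).offset
  linarith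

/-- If the pulse is never stuck, there are infinitely many passes. -/
theorem exists_offset_eq {w : List Γ} (h : ∀ i, ¬ (M.stageSeq w i).Stuck M) (m : ℕ) :
    ∃ i, (M.stageSeq w i).offset = m := by
  induction m with
  | zero => exact ⟨0, rfl⟩
  | succ m ih =>
    obtain ⟨i, hi⟩ := ih
    induction hr : (M.stageSeq w i).remaining using Nat.strong_induction_on generalizing i with
    | _ r ih =>
      have hv := M.stageSeq_valid w i
      rcases (hv.next_of_not_stuck (h i)).remaining_lt with h' | ⟨h₁, h₂⟩
      · exact ⟨i + 1, by rw [← hi]; exact h'⟩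
      · exact ih _ (hr ▸ h₂) (i + 1) (by rw [← hi]; exact h₁) rfl

theorem exists_cycle_lt {x : ℝ} (hx : 0 < x) : ∃ m : ℕ, cycle m < x := by
  obtain ⟨m, hm⟩ := exists_pow_lt_of_lt_one hx (show (1 / 2 : ℝ) < 1 by norm_num)
  refine ⟨m, ?_⟩
  rw [cycle, zpow_neg, zpow_natCast, ← inv_pow]
  simpa using hm

theorem six_le_of_forall_le {w : List Γ} (h : ∀ i, ¬ (M.stageSeq w i).Stuck M) {u : ℝ}
    (hu : ∀ i, M.timeSeq w i ≤ u) : 6 ≤ u := by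
  by_contra hlt
  obtain ⟨m, hm⟩ := exists_cycle_lt (show 0 < (6 - u) / 6 by linarith)
  obtain ⟨i, rfl⟩ := exists_offset_eq h m
  have h₁ := hu i
  rw [timeSeq_eq fun j _ => h j] at h₁
  have := (M.stageSeq w i).time_ge
  linarith

theorem cycle_lt_cycle_iff {a b : ℤ} : cycle a < cycle b ↔ b < a := by
  unfold cycle
  rw [zpow_lt_zpow_iff_right₀ one_lt_two]
  omega

/-- At a time `t` in the interval `[6 - 2⁻ᵏ, 6)`, the left delimiter has left cell `k`, since the
events of the pass that begins at cell `m` end at the time `6 - 3 · 2⁻ᵐ`. -/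
theorem isVanishing_stageSeq (w : List Γ) :
    IsVanishing (fun i => (M.stageSeq w i).cells) (M.timeSeq w) := by
  intro k t u ht htu hut hu
  by_cases hs : ∃ i, (M.stageSeq w i).Stuck M
  · obtain ⟨i, hi⟩ := hs
    obtain ⟨d, hd⟩ := exists_nat_gt (u - M.timeSeq w i)
    have := hu (i + d)
    rw [timeSeq_add_of_stuck hi] at this
    linarith
  · push Not at hs
    have h6 := six_le_of_forall_le hs hu
    by_cases h : ∃ n, t < M.timeSeq w n
    · obtain ⟨n, hn⟩ := h
      have E := M.isEventSequence_stageSeq w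
      obtain ⟨i, -, h₁, h₂⟩ := E.exists_index ht hn
      rw [E.stateAt_eq h₁ h₂]
      refine Stage.cells_of_lt (cycle_lt_cycle_iff.1 ?_)
      have hv := M.stageSeq_valid w i
      have h₃ := (hv.next_of_not_stuck (hs i)).time_le hv
      rw [timeSeq_eq fun j _ => hs j] at h₂
      have : (M.stageSeq w (i + 1)).time = ((M.stageSeq w i).succ M).time := rfl
      have := cycle_pos (M.stageSeq w i).offset
      linarith
    · push Not at h
      rw [stateAt_of_forall_le h]

/-! ### Halting of the Turing machine -/

/-- If the Turing machine halts, there is no infinite sequence of moves. -/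
theorem HaltsIn.acc {w : List Γ} {c c' : TMConfig Q Γ} (h : M.HaltsIn w c)
    (h' : M.Reaches w c') : Acc (fun d d' => M.step d' = some d) c' := by
  obtain ⟨hr, hs⟩ := h
  have h0 : Acc (fun d d' => M.step d' = some d) (M.initConfig w) := by
    unfold Reaches at hr
    generalize M.initConfig w = c₀ at hr
    induction hr using Relation.ReflTransGen.head_induction_on with
    | refl => exact ⟨_, fun d hd => by rw [hs] at hd; cases hd⟩
    | head h₁ _ ih =>
      refine ⟨_, fun d hd => ?_⟩
      rw [h₁] at hd
      cases hd
      exact ih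
  induction h' with
  | refl => exact h0
  | tail _ h₂ ih => exact ih.inv h₂

theorem HaltsIn.unique {w : List Γ} {c c' : TMConfig Q Γ} (h : M.HaltsIn w c)
    (h' : M.HaltsIn w c') : c = c' := by
  have hu : Relator.RightUnique fun c₁ c₂ => M.step c₁ = some c₂ := fun a b c hb hc => by
    simp only at hb hc; rw [hb] at hc; exact Option.some.inj hc
  rcases Relation.ReflTransGen.total_of_right_unique hu h.1 h'.1 with hr | hr
  · rcases hr.cases_head with rfl | ⟨d, hd, -⟩
    · rfl
    · rw [h.2] at hd; cases hd
  · rcases hr.cases_head with rfl | ⟨d, hd, -⟩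
    · rfl
    · rw [h'.2] at hd; cases hd

/-- If the Turing machine halts, the pulse gets stuck. The proof is by induction on the moves that
remain until it halts and, between two moves, on the pair of `passes` and `remaining`. -/
theorem exists_stuck_of_haltsOn {w : List Γ} (hM : M.StaysOnTape w) (h : M.HaltsOn w) :
    ∃ i, (M.stageSeq w i).Stuck M := by
  by_contra hs
  push Not at hs
  obtain ⟨c, hc⟩ := h
  have key : ∀ d, Acc (fun d d' => M.step d' = some d) d → ∀ i, (M.stageSeq w i).config ≠ d := by
    intro d hd
    induction hd with
    | intro d _ ih =>
      intro i hi
      have hlex : ∀ x : ℕ ×ₗ ℕ, ∀ i, (M.stageSeq w i).config = d →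
          toLex ((M.stageSeq w i).passes M, (M.stageSeq w i).remaining) ≠ x := by
        intro x
        induction x using WellFoundedLT.induction with
        | ind x ihx =>
          rintro i hi rfl
          have hv := M.stageSeq_valid w i
          rcases (hv.next_of_not_stuck (hs i)).step_or_progress hM hv with h | ⟨h₁, h₂⟩
          · rw [hi] at h
            exact ih _ h (i + 1) rfl
          · exact ihx _ (Prod.Lex.toLex_lt_toLex.2 h₂) (i + 1) (h₁.trans hi) rfl
      exact hlex _ i hi rfl
  exact key _ (hc.acc (M.stageSeq_valid w 0).reaches) 0 rfl

theorem Stage.Stuck.heldBetweenDelimiters {w : List Γ} {S : Stage Q Γ} (hS : S.Valid M w)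
    (h : S.Stuck M) : M.HeldBetweenDelimiters S.config S.cells := by
  have hh := hS.head_lt
  have hb := hS.blank
  have hp := hS.phase
  cases h with
  | @intro m n c l h₀ hl hδ =>
    simp only at hh hb hp
    refine ⟨m, n, hh, ?_, ?_, fun j hj => ?_, hb, fun k hk => ?_⟩
    · rw [Stage.cells, placeAt_of_nat (i := 0) (by simp), phaseStates_down_of_ne (by omega)]
      rfl
    · rw [Stage.cells, placeAt_of_nat (i := n + 1) (by push_cast; ring),
        phaseStates_down_of_ne (by omega), frame_delim]
    · rw [Stage.cells, placeAt_of_nat (i := j + 1) (by push_cast; ring)]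
      have : ∀ z : SimState Q Γ, (addArrow z).content = z.content := fun z => by cases z <;> rfl
      have h' : (phaseStates n c (.down l) (j + 1)).content = (tapeState c j).content := by
        simp only [phaseStates, frame_tape hj]
        split_ifs
        · exact this _
        · rfl
      simp only [h', tapeState]
      split_ifs <;> rfl
    · rcases hk with hk | hk
      · exact Stage.cells_of_lt hk
      · obtain ⟨i, rfl⟩ : ∃ i : ℕ, k = m + i := ⟨(k - m).toNat, by omega⟩
        rw [Stage.cells, placeAt_of_nat rfl]
        change phaseStates n c (.down l) i = quiet
        rw [phaseStates_down_of_ne (by omega), frame_of_gt (by omega)]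

end TuringMachine

open TuringMachine in
theorem mainTheorem2 {Q Γ : Type*} [Finite Q] [Finite Γ] (M : TuringMachine Q Γ)
    (amb : SimState Q Γ → SimState Q Γ → SimState Q Γ → SimState Q Γ)
    (w : List Γ) (hw : ∀ a ∈ w, a ∈ M.inputSymbols) (hM : M.StaysOnTape w) :
    ∃ s : ℤ → ℕ → SimState Q Γ,
      (M.simCA amb).IsEvolution (M.simInit w) s ∧
      (∀ s', (M.simCA amb).IsEvolution (M.simInit w) s' → s' = s) ∧
      (∀ c, M.HaltsIn w c →
        ∃ t : ℝ, 0 ≤ t ∧ t < 6 ∧ IsFinalAt s t ∧ M.HeldBetweenDelimiters c (configAt s t)) ∧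
      (¬ M.HaltsOn w →
        (∀ t : ℝ, 0 ≤ t → t < 6 → configAt s t ≠ fun _ => SimState.quiet) ∧
        ∀ t : ℝ, 6 ≤ t → configAt s t = fun _ => SimState.quiet) := by
  have E := M.isEventSequence_stageSeq w
  have V := M.isVanishing_stageSeq w
  have h0 : M.simInit w = (M.stageSeq w 0).cells := (initStage_cells w).symm
  refine ⟨eventStates (fun i => (M.stageSeq w i).cells) (M.timeSeq w), ?_, ?_, ?_, ?_⟩
  · rw [h0]; exact E.isEvolution V amb
  · intro s' hs'
    rw [h0] at hs'
    exact E.evolution_unique V (fun i => (M.stageSeq w i).exists_quiet) hs'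
  · intro c hc
    classical
    have hex := exists_stuck_of_haltsOn hM ⟨c, hc⟩
    obtain ⟨hN, hmin⟩ := And.intro (Nat.find_spec hex) fun j => Nat.find_min hex (m := j)
    generalize Nat.find hex = N at hN hmin
    -- from the first stage at which the pulse is stuck, the configuration is constant
    have hv := M.stageSeq_valid w N
    have hcells : ∀ t, M.timeSeq w N ≤ t →
        configAt (eventStates (fun i => (M.stageSeq w i).cells) (M.timeSeq w)) t =
          (M.stageSeq w N).cells := by
      intro t ht
      have ht0 := (E.nonneg N).trans ht
      rw [E.configAt_eventStates V ht0]
      obtain ⟨d, hd⟩ := exists_nat_gt (t - M.timeSeq w N)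
      have hlt : t < M.timeSeq w (N + d) := by rw [timeSeq_add_of_stuck hN]; linarith
      obtain ⟨i, -, h₁, h₂⟩ := E.exists_index ht0 hlt
      have hi : N ≤ i := Nat.le_of_lt_succ (E.strictMono.lt_iff_lt.1 (ht.trans_lt h₂))
      obtain ⟨e, rfl⟩ := Nat.exists_eq_add_of_le hi
      rw [E.stateAt_eq h₁ h₂, stageSeq_add_of_stuck hN]
    refine ⟨M.timeSeq w N, E.nonneg N, timeSeq_lt_six hmin, fun t' ht' => ?_, ?_⟩
    · rw [hcells t' ht', hcells _ le_rfl]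
    · rw [hcells _ le_rfl, hc.unique ⟨hv.reaches, hN.step_eq⟩]
      exact hN.heldBetweenDelimiters hv
  · intro hnot
    have hs : ∀ i, ¬ (M.stageSeq w i).Stuck M := fun i hi =>
      hnot ⟨_, (M.stageSeq_valid w i).reaches, hi.step_eq⟩
    have hlt : ∀ i, M.timeSeq w i < 6 := fun i => timeSeq_lt_six fun j _ => hs j
    refine ⟨fun t ht ht6 => ?_, fun t ht => ?_⟩
    · rw [E.configAt_eventStates V ht]
      obtain ⟨n, hn⟩ : ∃ n, t < M.timeSeq w n := by
        by_contra h
        push Not at h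
        exact absurd (six_le_of_forall_le hs h) (not_le.2 ht6)
      obtain ⟨i, -, h₁, h₂⟩ := E.exists_index ht hn
      rw [E.stateAt_eq h₁ h₂]
      exact fun h => (M.stageSeq_valid w i).cells_offset_ne (congrFun h _)
    · rw [E.configAt_eventStates V (by linarith), stateAt_of_forall_le]
      exact fun i => (hlt i).le.trans ht
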